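/- Let $x=(x^1,x^2)$, $y=(y^1,y^2)$ be coordinates in $\mathbb R^4$ and put $\delta=x^1y^2+x^2y^1$, $\rho=x^1x^2+y^1y^2$, $\sigma=x^1y^2-x^2y^1$. On the open set $\{\delta\neq0\}$ consider the codimension-two 3-web formed by the foliations $x=\mathrm{const}$, $y=\mathrm{const}$, $f(x,y)=\mathrm{const}$, where $$f^1=(x^1+y^1)(x^2-y^2),\qquad f^2=(x^1-y^1)(x^2+y^2).$$ Notation, for a 3-web given in this way by a map $f$ (indices run over $1,2$, repeated indices are summed, $[\,]$ and $(\,)$ denote alternation and symmetrization with weights $1/2!$, $1/3!$): $\omega_1^i=\frac{\partial f^i}{\partial x^j}dx^j$, $\omega_2^i=\frac{\partial f^i}{\partial y^j}dy^j$, with dual frame $E_{1j},E_{2j}$; $\Gamma^i_{jk}=-\partial^2f^i(E_{1j},E_{2k})$; the connection forms are $\omega^i_j=\Gamma^i_{kj}\omega_1^k+\Gamma^i_{jk}\omega_2^k$; the torsion tensor is $a^i_{jk}=\Gamma^i_{[jk]}=a_{[j}\delta^i_{k]}$, which defines the covector $a=(a_1,a_2)$; $p_{ij},q_{ij}$ are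 defined by $da_i-a_j\omega_i^j=p_{ij}\omega_1^j+q_{ij}\omega_2^j$, and $p=p_{[12]}$, $q=q_{[12]}$; the curvature tensor $b^i_{jkl}$ is defined by $d\omega^i_j-\omega^k_j\wedge\omega^i_k=b^i_{jkl}\,\omega_1^k\wedge\omega_2^l$. Where $a\ne0$, the transversal $a$-distribution $\Delta$ is the distribution of 2-planes $a_i\omega_1^i=0$, $a_i\omega_2^i=0$. The integral surfaces of $\Delta$ are geodesically parallel in an affine connection if $\Delta$ is parallel in it, i.e. $\nabla_vX$ lies in $\Delta$ for every vector field $X$ in $\Delta$ and every vector $v$. A planar 3-web is hexagonal if all its sufficiently small hexagonal figures close. A transversal plane at a point is a 2-plane $\xi^2\omega_1^1-\xi^1\omega_1^2=0$, $\xi^2\omega_2^1-\xi^1\omega_2^2=0$ with $\xi\neq0$; the web is transversally geodesic on an open set $U$ if every transversal plane at every point of $U$ is tangent to a surface in $U$ through this point all of whose tangent planes are transversal planes. Then: 1. These equations define a 3-web on $\{\delta\ne0\}$, and on this set $a_1=a_2=-\rho/\delta^2$ and $p=q=\rho\sigma/\delta^4$. In particular $p=q\neq0$ (so the web is nonisoclinic)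 exactly where $\rho\sigma\ne0$. 2. At every point of $\{\delta\neq0\}$ one has $a_1=a_2$ and $\pi_1^1+\pi_1^2-\pi_2^1-\pi_2^2=0$ (where $\pi^i_j$ is the restriction of $\omega^i_j$ to $\omega_1^k=\omega_2^k=0$); $p_{1i}=p_{2i}$ and $q_{1i}=q_{2i}$ for $i=1,2$; $p_{11}-2p_{(12)}+p_{22}=0$ and $q_{11}-2q_{(12)}+q_{22}=0$; and $-b^i_{111}+3(b^i_{(112)}-b^i_{(122)})+b^i_{222}=0$ for $i=1,2$. 3. On $\{\delta\ne0,\ \rho\neq0\}$, where $a\ne0$, the distribution $\Delta$ is given by $\omega_1^1+\omega_1^2=0$, $\omega_2^1+\omega_2^2=0$ and is integrable. Its integral surfaces are geodesically parallel in every affine connection with matrix $\mathrm{diag}(\theta,\theta)$, $\theta^i_j=\omega^i_j+a^i_{jk}(P\omega_1^k+Q\omega_2^k)$, in the frame $(E_{1i},E_{2i})$, where $P,Q$ are arbitrary functions; and the foliations of the web cut a hexagonal planar 3-web on each of these surfaces. 4. At no point of $\{\delta\neq0,\ \rho\neq0,\ \sigma\ne0\}$ is there a $(0,2)$-tensor $b_{kl}$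 with $b^i_{(jkl)}=\delta^i_{(j}b_{kl)}$, and the web is not transversally geodesic on any nonempty open subset of $\{\delta\neq0\}$. -/

import Mathlib

open scoped ContDiff Topology

noncomputable section

namespace ThreeWeb

/-- The plane `ℝ²`; the index `0` stands for the upper or lower index `1`, and `1` for `2`. -/
abbrev V2 : Type := Fin 2 → ℝ

/-- The ambient space `ℝ⁴`, with points `z = (x, y)`, `x = (x¹, x²)`, `y = (y¹, y²)`. -/
abbrev M4 : Type := V2 × V2

/-- The projection `(v, w) ↦ (v, 0)`. -/
def projX : M4 →L[ℝ] M4 :=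
  (ContinuousLinearMap.inl ℝ V2 V2).comp (ContinuousLinearMap.fst ℝ V2 V2)

/-- The projection `(v, w) ↦ (0, w)`. -/
def projY : M4 →L[ℝ] M4 :=
  (ContinuousLinearMap.inr ℝ V2 V2).comp (ContinuousLinearMap.snd ℝ V2 V2)

/-! ### The web with foliations `x = const`, `y = const`, `f (x, y) = const` -/

/-- The basis forms `ω₁ⁱ = (∂fⁱ/∂xʲ) dxʲ`. -/
def omega1 (f : M4 → V2) (i : Fin 2) (z : M4) : M4 →L[ℝ] ℝ :=
  (fderiv ℝ (fun w => f w i) z).comp projX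

/-- The basis forms `ω₂ⁱ = (∂fⁱ/∂yʲ) dyʲ`. The third family is `ω₃ⁱ = -(ω₁ⁱ + ω₂ⁱ) = -dfⁱ`. -/
def omega2 (f : M4 → V2) (i : Fin 2) (z : M4) : M4 →L[ℝ] ℝ :=
  (fderiv ℝ (fun w => f w i) z).comp projY

/-- The matrix `∂fⁱ/∂xʲ`. -/
def jacX (f : M4 → V2) (z : M4) : Matrix (Fin 2) (Fin 2) ℝ :=
  Matrix.of fun i j => fderiv ℝ (fun w => f w i) z (Pi.single j 1, 0)

/-- The matrix `∂fⁱ/∂yʲ`. -/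
def jacY (f : M4 → V2) (z : M4) : Matrix (Fin 2) (Fin 2) ℝ :=
  Matrix.of fun i j => fderiv ℝ (fun w => f w i) z (0, Pi.single j 1)

/-- The three foliations `x = const`, `y = const`, `f (x, y) = const` form a smooth three-web of
codimension two (pairwise transversal foliations) on the open set `U`. -/
def IsWebOn (f : M4 → V2) (U : Set M4) : Prop :=
  IsOpen U ∧ ContDiffOn ℝ ∞ f U ∧ ∀ z ∈ U, (jacX f z).det ≠ 0 ∧ (jacY f z).det ≠ 0

/-- The vectors `E₁ⱼ` of the frame dual to the coframe `(ω₁ⁱ, ω₂ⁱ)`: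
`ω₁ⁱ(E₁ⱼ) = δⁱⱼ`, `ω₂ⁱ(E₁ⱼ) = 0`. -/
def frame1 (f : M4 → V2) (j : Fin 2) (z : M4) : M4 :=
  (fun l => (jacX f z)⁻¹ l j, 0)

/-- The vectors `E₂ⱼ` of the dual frame: `ω₁ⁱ(E₂ⱼ) = 0`, `ω₂ⁱ(E₂ⱼ) = δⁱⱼ`. -/
def frame2 (f : M4 → V2) (j : Fin 2) (z : M4) : M4 :=
  (0, fun l => (jacY f z)⁻¹ l j)

/-- `Γⁱⱼₖ = -(∂²fⁱ/∂xˡ∂yᵐ) (E₁ⱼ)ˡ (E₂ₖ)ᵐ`. -/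
def Gam (f : M4 → V2) (i j k : Fin 2) (z : M4) : ℝ :=
  -(fderiv ℝ (fderiv ℝ (fun w => f w i)) z (frame1 f j z) (frame2 f k z))

/-- The connection forms of the web, `conn f i j = ωⱼⁱ = Γⁱₖⱼ ω₁ᵏ + Γⁱⱼₖ ω₂ᵏ`. -/
def conn (f : M4 → V2) (i j : Fin 2) (z : M4) : M4 →L[ℝ] ℝ :=
  ∑ k, (Gam f i k j z • omega1 f k z + Gam f i j k z • omega2 f k z)

/-- The torsion tensor `aⁱⱼₖ = Γⁱ_[jk]`. -/
def torsion (f : M4 → V2) (i j k : Fin 2) (z : M4) : ℝ :=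
  (Gam f i j k z - Gam f i k j z) / 2

/-- The covector `a` of the web. It is determined by
`aⁱⱼₖ = a_[j δⁱ_k] = (aⱼ δⁱₖ - aₖ δⁱⱼ) / 2`, whose trace over `i = k` is `aⁱⱼᵢ = aⱼ / 2`. -/
def covec (f : M4 → V2) (j : Fin 2) (z : M4) : ℝ :=
  2 * ∑ i, torsion f i j i z

/-- The covariant differential `∇aᵢ = daᵢ - aₖ ωᵢᵏ = pᵢⱼ ω₁ʲ + qᵢⱼ ω₂ʲ`. -/
def nablaCovec (f : M4 → V2) (i : Fin 2) (z : M4) : M4 →L[ℝ] ℝ :=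
  fderiv ℝ (covec f i) z - ∑ k, covec f k z • conn f k i z

/-- The Pfaffian derivatives `pᵢⱼ`. -/
def pT (f : M4 → V2) (i j : Fin 2) (z : M4) : ℝ := nablaCovec f i z (frame1 f j z)

/-- The Pfaffian derivatives `qᵢⱼ`. -/
def qT (f : M4 → V2) (i j : Fin 2) (z : M4) : ℝ := nablaCovec f i z (frame2 f j z)

/-- `p = p_[12]`. -/
def pInv (f : M4 → V2) (z : M4) : ℝ := (pT f 0 1 z - pT f 1 0 z) / 2

/-- `q = q_[12]`. -/
def qInv (f : M4 → V2) (z : M4) : ℝ := (qT f 0 1 z - qT f 1 0 z) / 2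

/-- The exterior derivative of a one-form on `ℝ⁴`. -/
def dForm (α : M4 → M4 →L[ℝ] ℝ) (z X Y : M4) : ℝ :=
  fderiv ℝ α z X Y - fderiv ℝ α z Y X

/-- The curvature two-forms `dωⱼⁱ - ωⱼᵏ ∧ ωₖⁱ = bⁱⱼₖₗ ω₁ᵏ ∧ ω₂ˡ`. -/
def curvForm (f : M4 → V2) (i j : Fin 2) (z X Y : M4) : ℝ :=
  dForm (conn f i j) z X Y
    - ∑ k, (conn f k j z X * conn f i k z Y - conn f k j z Y * conn f i k z X)

/-- The curvature tensor `bⁱⱼₖₗ`. -/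
def curv (f : M4 → V2) (i j k l : Fin 2) (z : M4) : ℝ :=
  curvForm f i j z (frame1 f k z) (frame2 f l z)

/-- Symmetrization `T_(jkl)` over three lower indices. -/
def sym3 (T : Fin 2 → Fin 2 → Fin 2 → ℝ) (j k l : Fin 2) : ℝ :=
  (T j k l + T j l k + T k j l + T k l j + T l j k + T l k j) / 6

/-- The symmetrized curvature tensor `bⁱ_(jkl)`. -/
def curvSym (f : M4 → V2) (i j k l : Fin 2) (z : M4) : ℝ :=
  sym3 (fun j k l => curv f i j k l z) j k l

/-- `bⁱ_(jkl) = δⁱ_(j b_kl)` at `z` for some `b_kl`. -/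
def CurvSymIsTrace (f : M4 → V2) (z : M4) : Prop :=
  ∃ c : Fin 2 → Fin 2 → ℝ, ∀ i j k l : Fin 2,
    curvSym f i j k l z = sym3 (fun j k l => if i = j then c k l else 0) j k l

/-! ### Surfaces and the transversal distributions -/

/-- A smooth parametrized (immersed) surface in `ℝ⁴` over the open set `O` of `ℝ²`. -/
def IsSurface (O : Set (ℝ × ℝ)) (φ : ℝ × ℝ → M4) : Prop :=
  IsOpen O ∧ ContDiffOn ℝ ∞ φ O ∧ ∀ s ∈ O, Function.Injective (fderiv ℝ φ s)

/-- The tangent plane of a parametrized surface at the parameter `s`. -/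
def tangentPlane (φ : ℝ × ℝ → M4) (s : ℝ × ℝ) : Submodule ℝ M4 :=
  LinearMap.range (fderiv ℝ φ s).toLinearMap

/-- The surface `φ` over `O` is an integral surface of the distribution `D`. -/
def IsIntegralSurface (D : M4 → Submodule ℝ M4) (O : Set (ℝ × ℝ)) (φ : ℝ × ℝ → M4) : Prop :=
  IsSurface O φ ∧ ∀ s ∈ O, tangentPlane φ s = D (φ s)

/-- The distribution `D` of planes is integrable on `U`: through every point of `U` there passes
an integral surface. -/
def IsIntegrableOn (D : M4 → Submodule ℝ M4) (U : Set M4) : Prop :=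
  ∀ z ∈ U, ∃ (O : Set (ℝ × ℝ)) (φ : ℝ × ℝ → M4), 0 ∈ O ∧ φ 0 = z ∧
    Set.MapsTo φ O U ∧ IsIntegralSurface D O φ

/-- The transversal `a`-distribution `Δ`: `a₁ω₁¹ + a₂ω₁² = 0`, `a₁ω₂¹ + a₂ω₂² = 0`. -/
def aDist (f : M4 → V2) (z : M4) : Submodule ℝ M4 :=
  LinearMap.ker (∑ i, covec f i z • omega1 f i z).toLinearMap ⊓
    LinearMap.ker (∑ i, covec f i z • omega2 f i z).toLinearMap

/-- The transversal plane given by the direction `ξ ≠ 0`: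
`ξ²ω₁¹ - ξ¹ω₁² = 0`, `ξ²ω₂¹ - ξ¹ω₂² = 0`. -/
def transPlane (f : M4 → V2) (z : M4) (ξ : V2) : Submodule ℝ M4 :=
  LinearMap.ker (ξ 1 • omega1 f 0 z - ξ 0 • omega1 f 1 z).toLinearMap ⊓
    LinearMap.ker (ξ 1 • omega2 f 0 z - ξ 0 • omega2 f 1 z).toLinearMap

/-- The web is transversally geodesic on `U`: every transversal plane at every point of `U` is
tangent there to a surface of `U` all of whose tangent planes are transversal planes. (Such a
surface is automatically totally geodesic for the connection of the web.) -/
def IsTransversallyGeodesicOn (f : M4 → V2) (U : Set M4) : Prop :=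
  ∀ z ∈ U, ∀ ξ : V2, ξ ≠ 0 → ∃ (O : Set (ℝ × ℝ)) (φ : ℝ × ℝ → M4),
    0 ∈ O ∧ φ 0 = z ∧ Set.MapsTo φ O U ∧ IsSurface O φ ∧
    tangentPlane φ 0 = transPlane f z ξ ∧
    ∀ s ∈ O, ∃ η : V2, η ≠ 0 ∧ tangentPlane φ s = transPlane f (φ s) η

/-! ### Geodesic parallelism -/

/-- The forms `θⱼⁱ = ωⱼⁱ + aⁱⱼₖ (P ω₁ᵏ + Q ω₂ᵏ)` of a connection of the bundle of affine
connections of the web; `P` and `Q` are arbitrary functions. -/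
def theta (f : M4 → V2) (P Q : M4 → ℝ) (i j : Fin 2) (z : M4) : M4 →L[ℝ] ℝ :=
  conn f i j z + ∑ k, torsion f i j k z • (P z • omega1 f k z + Q z • omega2 f k z)

/-- The covariant derivative `∇_v X` at `z` in the affine connection whose matrix in the frame
`(E₁₁, E₁₂, E₂₁, E₂₂)` is `diag (θ, θ)`. -/
def covDeriv (f : M4 → V2) (P Q : M4 → ℝ) (X : M4 → M4) (z v : M4) : M4 :=
  ∑ i, ((fderiv ℝ (fun w => omega1 f i w (X w)) z v
          + ∑ j, theta f P Q i j z v * omega1 f j z (X z)) • frame1 f i z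
      + (fderiv ℝ (fun w => omega2 f i w (X w)) z v
          + ∑ j, theta f P Q i j z v * omega2 f j z (X z)) • frame2 f i z)

/-- The integral surfaces of `D` in `U` are geodesically parallel in the connection `θ`: the
distribution of their tangent planes is parallel, that is, for every vector field `X` tangent to
them and every vector `v` (tangent to them or not), `∇_v X` is tangent to them. -/
def IsGeodesicallyParallelOn (f : M4 → V2) (P Q : M4 → ℝ) (D : M4 → Submodule ℝ M4)
    (U : Set M4) : Prop :=
  ∀ z ∈ U, ∀ X : M4 → M4, DifferentiableAt ℝ X z → (∀ᶠ w in 𝓝 z, X w ∈ D w) →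
    ∀ v : M4, covDeriv f P Q X z v ∈ D z

/-! ### Hexagonal two-dimensional webs -/

/-- Every hexagonal figure of the families of level sets of `h₁`, `h₂`, `h₃` inside `N` closes:
`P₀` is the centre; the diagonals `P₁P₄`, `P₂P₅`, `P₃P₆` lie on the leaves of the families
1, 2, 3 through `P₀`; the sides `P₁P₂`, `P₂P₃`, `P₃P₄`, `P₄P₅`, `P₅P₆` lie on leaves of the
families 3, 1, 2, 3, 1. Then `P₆P₁` lies on a leaf of the family 2. -/
def HexagonsClose (h₁ h₂ h₃ : ℝ × ℝ → V2) (N : Set (ℝ × ℝ)) : Prop :=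
  ∀ P₀ ∈ N, ∀ P₁ ∈ N, ∀ P₂ ∈ N, ∀ P₃ ∈ N, ∀ P₄ ∈ N, ∀ P₅ ∈ N, ∀ P₆ ∈ N,
    h₁ P₁ = h₁ P₀ → h₁ P₄ = h₁ P₀ →
    h₂ P₂ = h₂ P₀ → h₂ P₅ = h₂ P₀ →
    h₃ P₃ = h₃ P₀ → h₃ P₆ = h₃ P₀ →
    h₃ P₁ = h₃ P₂ → h₁ P₂ = h₁ P₃ → h₂ P₃ = h₂ P₄ → h₃ P₄ = h₃ P₅ → h₁ P₅ = h₁ P₆ →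
    h₂ P₆ = h₂ P₁

/-- The level sets of `h₁`, `h₂`, `h₃` form a two-dimensional three-web on `O`: at each point the
three tangent directions are lines, pairwise distinct. -/
def IsPlanarWeb (h₁ h₂ h₃ : ℝ × ℝ → V2) (O : Set (ℝ × ℝ)) : Prop :=
  ContDiffOn ℝ ∞ h₁ O ∧ ContDiffOn ℝ ∞ h₂ O ∧ ContDiffOn ℝ ∞ h₃ O ∧ ∀ s ∈ O,
    Module.finrank ℝ (LinearMap.ker (fderiv ℝ h₁ s).toLinearMap) = 1 ∧
    Module.finrank ℝ (LinearMap.ker (fderiv ℝ h₂ s).toLinearMap) = 1 ∧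
    Module.finrank ℝ (LinearMap.ker (fderiv ℝ h₃ s).toLinearMap) = 1 ∧
    LinearMap.ker (fderiv ℝ h₁ s).toLinearMap ⊓ LinearMap.ker (fderiv ℝ h₂ s).toLinearMap = ⊥ ∧
    LinearMap.ker (fderiv ℝ h₁ s).toLinearMap ⊓ LinearMap.ker (fderiv ℝ h₃ s).toLinearMap = ⊥ ∧
    LinearMap.ker (fderiv ℝ h₂ s).toLinearMap ⊓ LinearMap.ker (fderiv ℝ h₃ s).toLinearMap = ⊥

/-- The foliations of the web cut on the surface `φ` over `O` a two-dimensional three-web which is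
hexagonal: all sufficiently small hexagonal figures close. -/
def CutsHexagonalWeb (f : M4 → V2) (O : Set (ℝ × ℝ)) (φ : ℝ × ℝ → M4) : Prop :=
  IsPlanarWeb (fun s => (φ s).1) (fun s => (φ s).2) (fun s => f (φ s)) O ∧
    ∀ s ∈ O, ∃ N ∈ 𝓝 s, N ⊆ O ∧
      HexagonsClose (fun t => (φ t).1) (fun t => (φ t).2) (fun t => f (φ t)) N

/-! ### Pointwise conditions on the tensors of a web -/

/-- `a₁ = a₂` and `π₁¹ + π₁² - π₂¹ - π₂² = 0`, where `πⱼⁱ` is the restriction of `ωⱼⁱ` to the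
common kernel of the forms `ω₁ᵏ`, `ω₂ᵏ`. -/
def EqualCovecCond (f : M4 → V2) (z : M4) : Prop :=
  covec f 0 z = covec f 1 z ∧
    ∀ v : M4, (∀ k, omega1 f k z v = 0 ∧ omega2 f k z v = 0) →
      conn f 0 0 z v + conn f 1 0 z v - conn f 0 1 z v - conn f 1 1 z v = 0

/-- `p₁₁ - 2p_(12) + p₂₂ = 0`, `q₁₁ - 2q_(12) + q₂₂ = 0`. -/
def IntegrabilityCond (f : M4 → V2) (z : M4) : Prop :=
  pT f 0 0 z - (pT f 0 1 z + pT f 1 0 z) + pT f 1 1 z = 0 ∧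
    qT f 0 0 z - (qT f 0 1 z + qT f 1 0 z) + qT f 1 1 z = 0

/-- `p₁ᵢ = p₂ᵢ`, `q₁ᵢ = q₂ᵢ`. -/
def ParallelCond (f : M4 → V2) (z : M4) : Prop :=
  ∀ i, pT f 0 i z = pT f 1 i z ∧ qT f 0 i z = qT f 1 i z

/-- `-bⁱ₁₁₁ + 3(bⁱ_(112) - bⁱ_(122)) + bⁱ₂₂₂ = 0`, `i = 1, 2`. -/
def HexagonalCond (f : M4 → V2) (z : M4) : Prop :=
  ∀ i, -curv f i 0 0 0 z + 3 * (curvSym f i 0 0 1 z - curvSym f i 0 1 1 z)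
    + curv f i 1 1 1 z = 0

/-! ### The web of the example -/

/-- `u₃¹ = (x¹ + y¹)(x² - y²)`, `u₃² = (x¹ - y¹)(x² + y²)`. -/
def exWeb (z : M4) : V2 :=
  ![(z.1 0 + z.2 0) * (z.1 1 - z.2 1), (z.1 0 - z.2 0) * (z.1 1 + z.2 1)]

/-- `x¹y² + x²y¹`. -/
def dlt (z : M4) : ℝ := z.1 0 * z.2 1 + z.1 1 * z.2 0

/-- `ρ = x¹x² + y¹y²`. -/
def rho (z : M4) : ℝ := z.1 0 * z.1 1 + z.2 0 * z.2 1

/-- `σ = x¹y² - x²y¹`. -/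
def sigm (z : M4) : ℝ := z.1 0 * z.2 1 - z.1 1 * z.2 0

/-- The domain of the web. -/
def dom : Set M4 := {z | dlt z ≠ 0}

/-- The part of the domain where the covector `a` does not vanish, so that `Δ` is defined. -/
def domA : Set M4 := {z | dlt z ≠ 0 ∧ rho z ≠ 0}

/-- The part of the domain where the web is nonisoclinic. -/
def domN : Set M4 := {z | dlt z ≠ 0 ∧ rho z ≠ 0 ∧ sigm z ≠ 0}

end ThreeWeb

end

open ThreeWeb

namespace ThreeWeb

/-! Everything except the curvature formulas and the failure of transversal geodesicity comes from
two identities: f¹ + f² = 2(x¹x² - y¹y²) and f² - f¹ = 2σ. The first sum has no mixed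
xy-derivatives, so Γ²ⱼₖ = -Γ¹ⱼₖ (`Gam_exWeb_one`). Hence the connection, torsion and curvature
components with upper index 2 are the negatives of those with upper index 1. This gives a₁ = a₂, ∇aᵢ
= daᵢ and the parallelism of Δ.

The sums ω₁¹ + ω₁² and ω₂¹ + ω₂² are 2d(x¹x²) and -2d(y¹y²). The integral surfaces of Δ therefore
have x¹x² = A and y¹y² = B locally constant. Where m = x¹y² ≠ 0, fixing f on such a surface means
fixing σ = m - AB/m, which locally determines m because dσ/dm = δ/m. The cut web is thus x¹, y²,
x¹y² = const, and it is hexagonal (`hexagonsClose_of_mul`); where x¹y² = 0 one uses x²y¹ instead.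

For the tensor statement of item 4, a trace form would kill b²₁₁₁ and b¹₂₂₂, which are multiples of
ρf² and ρf¹. Both vanish only if ρσ = 0.

For the geometric statement, a surface with transversal tangent planes that projects locally
diffeomorphically to the (x¹, y¹)-plane is a graph x² = β(x¹), y² = γ(y¹) satisfying one first-order
equation. Differentiating that equation where β' = 0 forces δ(x²)²((x²)² - (y²)²) = 0
(`mul_dlt_eq_zero_of_graph`), which fails at a generic point (`exists_generic_mem`). -/

/-- The coordinate form `dxⁱ`. -/
def dX (i : Fin 2) : M4 →L[ℝ] ℝ :=
  (ContinuousLinearMap.proj i : V2 →L[ℝ] ℝ).comp (ContinuousLinearMap.fst ℝ V2 V2)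

/-- The coordinate form `dyⁱ`. -/
def dY (i : Fin 2) : M4 →L[ℝ] ℝ :=
  (ContinuousLinearMap.proj i : V2 →L[ℝ] ℝ).comp (ContinuousLinearMap.snd ℝ V2 V2)

@[simp] lemma dX_apply (i : Fin 2) (v : M4) : dX i v = v.1 i := rfl
@[simp] lemma dY_apply (i : Fin 2) (v : M4) : dY i v = v.2 i := rfl

/-! ### Derivatives of f, basis forms and Jacobians. -/

lemma hasFDerivAt_x (i : Fin 2) (z : M4) : HasFDerivAt (fun w : M4 => w.1 i) (dX i) z :=
  (dX i).hasFDerivAt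

lemma hasFDerivAt_y (i : Fin 2) (z : M4) : HasFDerivAt (fun w : M4 => w.2 i) (dY i) z :=
  (dY i).hasFDerivAt

lemma hasFDerivAt_exWeb_zero (z : M4) : HasFDerivAt (fun w => exWeb w 0)
    ((z.1 0 + z.2 0) • (dX 1 - dY 1) + (z.1 1 - z.2 1) • (dX 0 + dY 0)) z :=
  ((hasFDerivAt_x 0 z).add (hasFDerivAt_y 0 z)).mul
    ((hasFDerivAt_x 1 z).sub (hasFDerivAt_y 1 z))

lemma hasFDerivAt_exWeb_one (z : M4) : HasFDerivAt (fun w => exWeb w 1)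
    ((z.1 0 - z.2 0) • (dX 1 + dY 1) + (z.1 1 + z.2 1) • (dX 0 - dY 0)) z :=
  ((hasFDerivAt_x 0 z).sub (hasFDerivAt_y 0 z)).mul
    ((hasFDerivAt_x 1 z).add (hasFDerivAt_y 1 z))

lemma fderiv_exWeb_zero : fderiv ℝ (fun w => exWeb w 0) = fun z : M4 =>
    (z.1 0 + z.2 0) • (dX 1 - dY 1) + (z.1 1 - z.2 1) • (dX 0 + dY 0) :=
  funext fun z => (hasFDerivAt_exWeb_zero z).fderiv

lemma fderiv_exWeb_one : fderiv ℝ (fun w => exWeb w 1) = fun z : M4 =>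
    (z.1 0 - z.2 0) • (dX 1 + dY 1) + (z.1 1 + z.2 1) • (dX 0 - dY 0) :=
  funext fun z => (hasFDerivAt_exWeb_one z).fderiv

lemma hessian_exWeb_zero (z v w : M4) :
    fderiv ℝ (fderiv ℝ (fun w => exWeb w 0)) z v w =
      (v.1 0 + v.2 0) * (w.1 1 - w.2 1) + (v.1 1 - v.2 1) * (w.1 0 + w.2 0) := by
  rw [fderiv_exWeb_zero]
  have h := (((hasFDerivAt_x 0 z).add (hasFDerivAt_y 0 z)).smul_const (dX 1 - dY 1)).add
    (((hasFDerivAt_x 1 z).sub (hasFDerivAt_y 1 z)).smul_const (dX 0 + dY 0))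
  have h' := h.fderiv
  simp only [Pi.add_def, Pi.sub_def] at h'
  rw [h']
  simp
  ring

lemma hessian_exWeb_one (z v w : M4) :
    fderiv ℝ (fderiv ℝ (fun w => exWeb w 1)) z v w =
      (v.1 0 - v.2 0) * (w.1 1 + w.2 1) + (v.1 1 + v.2 1) * (w.1 0 - w.2 0) := by
  rw [fderiv_exWeb_one]
  have h := (((hasFDerivAt_x 0 z).sub (hasFDerivAt_y 0 z)).smul_const (dX 1 + dY 1)).add
    (((hasFDerivAt_x 1 z).add (hasFDerivAt_y 1 z)).smul_const (dX 0 - dY 0))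
  have h' := h.fderiv
  simp only [Pi.add_def, Pi.sub_def] at h'
  rw [h']
  simp
  ring

lemma omega1_exWeb_zero (z v : M4) :
    omega1 exWeb 0 z v = (z.1 1 - z.2 1) * v.1 0 + (z.1 0 + z.2 0) * v.1 1 := by
  simp [omega1, fderiv_exWeb_zero, projX, -Fin.isValue]; ring

lemma omega1_exWeb_one (z v : M4) :
    omega1 exWeb 1 z v = (z.1 1 + z.2 1) * v.1 0 + (z.1 0 - z.2 0) * v.1 1 := by
  simp [omega1, fderiv_exWeb_one, projX, -Fin.isValue]; ring

lemma omega2_exWeb_zero (z v : M4) :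
    omega2 exWeb 0 z v = (z.1 1 - z.2 1) * v.2 0 - (z.1 0 + z.2 0) * v.2 1 := by
  simp [omega2, fderiv_exWeb_zero, projY, -Fin.isValue]; ring

lemma omega2_exWeb_one (z v : M4) :
    omega2 exWeb 1 z v = -(z.1 1 + z.2 1) * v.2 0 + (z.1 0 - z.2 0) * v.2 1 := by
  simp [omega2, fderiv_exWeb_one, projY, -Fin.isValue]; ring

lemma jacX_exWeb (z : M4) :
    jacX exWeb z = !![z.1 1 - z.2 1, z.1 0 + z.2 0; z.1 1 + z.2 1, z.1 0 - z.2 0] := by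
  ext i j
  fin_cases i <;> fin_cases j <;> simp [jacX, fderiv_exWeb_zero, fderiv_exWeb_one]

lemma jacY_exWeb (z : M4) :
    jacY exWeb z = !![z.1 1 - z.2 1, -(z.1 0 + z.2 0); -(z.1 1 + z.2 1), z.1 0 - z.2 0] := by
  ext i j
  fin_cases i <;> fin_cases j <;> simp [jacY, fderiv_exWeb_zero, fderiv_exWeb_one]

lemma det_jacX_exWeb (z : M4) : (jacX exWeb z).det = -2 * dlt z := by
  rw [jacX_exWeb, Matrix.det_fin_two_of, dlt]; ring

lemma det_jacY_exWeb (z : M4) : (jacY exWeb z).det = -2 * dlt z := by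
  rw [jacY_exWeb, Matrix.det_fin_two_of, dlt]; ring

lemma continuous_dlt : Continuous dlt := by unfold dlt; fun_prop

lemma continuous_rho : Continuous rho := by unfold rho; fun_prop

lemma isOpen_dom : IsOpen dom := isOpen_ne_fun continuous_dlt continuous_const

lemma contDiff_exWeb : ContDiff ℝ ∞ exWeb := by
  rw [contDiff_pi]
  intro i
  fin_cases i <;> simp [exWeb] <;> fun_prop

lemma isWebOn_exWeb : IsWebOn exWeb dom := by
  refine ⟨isOpen_dom, contDiff_exWeb.contDiffOn, fun z hz => ?_⟩
  have hz' : dlt z ≠ 0 := hz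
  rw [det_jacX_exWeb, det_jacY_exWeb]
  exact ⟨by simpa using hz', by simpa using hz'⟩

/-! ### The dual frame and the connection of the example -/

lemma frame1_exWeb_zero {z : M4} (hz : z ∈ dom) : frame1 exWeb 0 z =
    (![-(z.1 0 - z.2 0) / (2 * dlt z), (z.1 1 + z.2 1) / (2 * dlt z)], 0) := by
  have hz' : dlt z ≠ 0 := hz
  refine Prod.ext (funext fun l => ?_) rfl
  rw [frame1, Matrix.inv_def, det_jacX_exWeb, jacX_exWeb]
  fin_cases l <;> simp [Matrix.adjugate_fin_two_of, Ring.inverse_eq_inv'] <;> field_simp <;> ring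

lemma frame1_exWeb_one {z : M4} (hz : z ∈ dom) : frame1 exWeb 1 z =
    (![(z.1 0 + z.2 0) / (2 * dlt z), -(z.1 1 - z.2 1) / (2 * dlt z)], 0) := by
  have hz' : dlt z ≠ 0 := hz
  refine Prod.ext (funext fun l => ?_) rfl
  rw [frame1, Matrix.inv_def, det_jacX_exWeb, jacX_exWeb]
  fin_cases l <;> simp [Matrix.adjugate_fin_two_of, Ring.inverse_eq_inv'] <;> field_simp <;> ring

lemma frame2_exWeb_zero {z : M4} (hz : z ∈ dom) : frame2 exWeb 0 z =
    (0, ![-(z.1 0 - z.2 0) / (2 * dlt z), -(z.1 1 + z.2 1) / (2 * dlt z)]) := by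
  have hz' : dlt z ≠ 0 := hz
  refine Prod.ext rfl (funext fun l => ?_)
  rw [frame2, Matrix.inv_def, det_jacY_exWeb, jacY_exWeb]
  fin_cases l <;> simp [Matrix.adjugate_fin_two_of, Ring.inverse_eq_inv'] <;> field_simp <;> ring

lemma frame2_exWeb_one {z : M4} (hz : z ∈ dom) : frame2 exWeb 1 z =
    (0, ![-(z.1 0 + z.2 0) / (2 * dlt z), -(z.1 1 - z.2 1) / (2 * dlt z)]) := by
  have hz' : dlt z ≠ 0 := hz
  refine Prod.ext rfl (funext fun l => ?_)
  rw [frame2, Matrix.inv_def, det_jacY_exWeb, jacY_exWeb]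
  fin_cases l <;> simp [Matrix.adjugate_fin_two_of, Ring.inverse_eq_inv'] <;> field_simp <;> ring

/-- The sum f¹ + f² = 2(x¹x² - y¹y²) has zero mixed xy-Hessian. All later sign symmetries between
the upper indices `0` and `1` come from here. -/
lemma Gam_exWeb_one (j k : Fin 2) (z : M4) : Gam exWeb 1 j k z = -Gam exWeb 0 j k z := by
  rw [Gam, Gam, hessian_exWeb_zero, hessian_exWeb_one]
  simp only [frame1, frame2, Pi.zero_apply]
  ring

lemma Gam_exWeb_zero {z : M4} (hz : z ∈ dom) (j k : Fin 2) : Gam exWeb 0 j k z =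
    !![exWeb z 1, rho z; -rho z, -exWeb z 0] j k / (2 * dlt z ^ 2) := by
  have hz' : dlt z ≠ 0 := hz
  rw [Gam, hessian_exWeb_zero]
  fin_cases j <;> fin_cases k <;>
    simp [frame1_exWeb_zero hz, frame1_exWeb_one hz, frame2_exWeb_zero hz, frame2_exWeb_one hz,
      exWeb, rho] <;> field_simp <;> ring

lemma conn_exWeb_one (j : Fin 2) (z : M4) : conn exWeb 1 j z = -conn exWeb 0 j z := by
  simp only [conn, Gam_exWeb_one, Fin.sum_univ_two]
  module

/-- The numerator of the connection form `ω₁¹` of the example, `2δ ω₁¹`. -/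
def connNum₀ (z : M4) : M4 →L[ℝ] ℝ :=
  (z.1 0 - z.2 0) • (dX 1 - dY 1) - (z.1 1 + z.2 1) • (dX 0 + dY 0)

/-- The numerator of the connection form `ω₂¹` of the example, `2δ ω₂¹`. -/
def connNum₁ (z : M4) : M4 →L[ℝ] ℝ :=
  (z.1 0 + z.2 0) • (dX 1 + dY 1) - (z.1 1 - z.2 1) • (dX 0 - dY 0)

/-- The numerators `2δ ωⱼ¹` of the connection forms of the example. -/
def connNum (j : Fin 2) : M4 → M4 →L[ℝ] ℝ := ![connNum₀, connNum₁] j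

lemma conn_exWeb_zero {z : M4} (hz : z ∈ dom) (j : Fin 2) :
    conn exWeb 0 j z = (2 * dlt z)⁻¹ • connNum j z := by
  have hz' : dlt z ≠ 0 := hz
  ext v
  · fin_cases j <;>
    simp [conn, Gam_exWeb_zero hz, omega1_exWeb_zero, omega1_exWeb_one, omega2_exWeb_zero,
      omega2_exWeb_one, connNum, connNum₀, connNum₁] <;> field_simp <;> simp [exWeb, rho, dlt] <;>
    ring
  · fin_cases j <;>
    simp [conn, Gam_exWeb_zero hz, omega1_exWeb_zero, omega1_exWeb_one, omega2_exWeb_zero,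
      omega2_exWeb_one, connNum, connNum₀, connNum₁] <;> field_simp <;> simp [exWeb, rho, dlt] <;>
    ring

/-! ### Torsion, the covector a and its covariant differential. -/

lemma torsion_exWeb_one (j k : Fin 2) (z : M4) :
    torsion exWeb 1 j k z = -torsion exWeb 0 j k z := by
  simp only [torsion, Gam_exWeb_one]; ring

lemma covec_exWeb {z : M4} (hz : z ∈ dom) (j : Fin 2) :
    covec exWeb j z = -rho z / dlt z ^ 2 := by
  have hz' : dlt z ≠ 0 := hz
  fin_cases j <;> simp [covec, torsion, Gam_exWeb_one, Gam_exWeb_zero hz] <;> field_simp <;> ring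

/-- The differential `dδ`. -/
def dDlt (z : M4) : M4 →L[ℝ] ℝ :=
  z.1 0 • dY 1 + z.2 1 • dX 0 + (z.1 1 • dY 0 + z.2 0 • dX 1)

/-- The differential `dρ`. -/
def dRho (z : M4) : M4 →L[ℝ] ℝ :=
  z.1 0 • dX 1 + z.1 1 • dX 0 + (z.2 0 • dY 1 + z.2 1 • dY 0)

lemma hasFDerivAt_dlt (z : M4) : HasFDerivAt dlt (dDlt z) z :=
  ((hasFDerivAt_x 0 z).mul (hasFDerivAt_y 1 z)).add ((hasFDerivAt_x 1 z).mul (hasFDerivAt_y 0 z))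

lemma hasFDerivAt_rho (z : M4) : HasFDerivAt rho (dRho z) z :=
  ((hasFDerivAt_x 0 z).mul (hasFDerivAt_x 1 z)).add ((hasFDerivAt_y 0 z).mul (hasFDerivAt_y 1 z))

lemma fderiv_covec_exWeb {z : M4} (hz : z ∈ dom) (j : Fin 2) (v : M4) :
    fderiv ℝ (covec exWeb j) z v =
      (2 * rho z * dDlt z v - dlt z * dRho z v) / dlt z ^ 3 := by
  have hz' : dlt z ≠ 0 := hz
  -- The closed form is available only on `dom`; openness of `dom` allows it to be differentiated.
  have he : covec exWeb j =ᶠ[𝓝 z] fun w => -rho w * (dlt w ^ 2)⁻¹ := by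
    filter_upwards [isOpen_dom.mem_nhds hz] with w hw
    rw [covec_exWeb hw, div_eq_mul_inv]
  have h := (hasFDerivAt_rho z).neg.mul
    (((hasDerivAt_inv (pow_ne_zero 2 hz')).comp_hasFDerivAt z ((hasFDerivAt_dlt z).pow 2)))
  have h' : fderiv ℝ (fun w => -rho w * (dlt w ^ 2)⁻¹) z = _ := h.fderiv
  rw [he.fderiv_eq, h']
  simp
  field_simp
  ring

/-- Since a₁ = a₂ and ωᵢ² = -ωᵢ¹, the terms aₖωᵢᵏ cancel and ∇aᵢ = daᵢ. The right side does not
involve `i`, which is exactly `ParallelCond`. -/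
lemma nablaCovec_exWeb {z : M4} (hz : z ∈ dom) (i : Fin 2) (v : M4) :
    nablaCovec exWeb i z v = (2 * rho z * dDlt z v - dlt z * dRho z v) / dlt z ^ 3 := by
  simp only [nablaCovec, sub_apply, fderiv_covec_exWeb hz, Fin.sum_univ_two,
    covec_exWeb hz, conn_exWeb_one]
  simp

lemma parallelCond_exWeb {z : M4} (hz : z ∈ dom) : ParallelCond exWeb z := fun i => by
  simp only [pT, qT, nablaCovec_exWeb hz, and_self]

lemma integrabilityCond_exWeb {z : M4} (hz : z ∈ dom) : IntegrabilityCond exWeb z := by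
  obtain ⟨h0, k0⟩ := parallelCond_exWeb hz 0
  obtain ⟨h1, k1⟩ := parallelCond_exWeb hz 1
  constructor <;> linarith

lemma pInv_exWeb {z : M4} (hz : z ∈ dom) : pInv exWeb z = rho z * sigm z / dlt z ^ 4 := by
  have hz' : dlt z ≠ 0 := hz
  simp [pInv, pT, nablaCovec_exWeb hz, frame1_exWeb_zero hz, frame1_exWeb_one hz, dDlt, dRho]
  field_simp
  simp [rho, sigm, dlt]
  ring

lemma qInv_exWeb {z : M4} (hz : z ∈ dom) : qInv exWeb z = rho z * sigm z / dlt z ^ 4 := by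
  have hz' : dlt z ≠ 0 := hz
  simp [qInv, qT, nablaCovec_exWeb hz, frame2_exWeb_zero hz, frame2_exWeb_one hz, dDlt, dRho]
  field_simp
  simp [rho, sigm, dlt]
  ring

/-- Where δ ≠ 0 the four forms are a coframe of ℝ⁴. The condition on the forms π in `EqualCovecCond`
is therefore only tested on v = 0. -/
lemma eq_zero_of_omega_exWeb {z : M4} (hz : z ∈ dom) {v : M4}
    (hv : ∀ k, omega1 exWeb k z v = 0 ∧ omega2 exWeb k z v = 0) : v = 0 := by
  have hz' : dlt z ≠ 0 := hz
  have h1 := (hv 0).1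
  have h2 := (hv 1).1
  have h3 := (hv 0).2
  have h4 := (hv 1).2
  rw [omega1_exWeb_zero] at h1
  rw [omega1_exWeb_one] at h2
  rw [omega2_exWeb_zero] at h3
  rw [omega2_exWeb_one] at h4
  refine Prod.ext (funext fun l => ?_) (funext fun l => ?_)
  · have k0 : dlt z * v.1 0 = 0 := by
      simp only [dlt]; linear_combination (-(z.1 0 - z.2 0) / 2) * h1 + (z.1 0 + z.2 0) / 2 * h2
    have k1 : dlt z * v.1 1 = 0 := by
      simp only [dlt]; linear_combination ((z.1 1 + z.2 1) / 2) * h1 - (z.1 1 - z.2 1) / 2 * h2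
    fin_cases l
    exacts [(mul_eq_zero.1 k0).resolve_left hz', (mul_eq_zero.1 k1).resolve_left hz']
  · have k0 : dlt z * v.2 0 = 0 := by
      simp only [dlt]; linear_combination (-(z.1 0 - z.2 0) / 2) * h3 - (z.1 0 + z.2 0) / 2 * h4
    have k1 : dlt z * v.2 1 = 0 := by
      simp only [dlt]; linear_combination (-(z.1 1 + z.2 1) / 2) * h3 - (z.1 1 - z.2 1) / 2 * h4
    fin_cases l
    exacts [(mul_eq_zero.1 k0).resolve_left hz', (mul_eq_zero.1 k1).resolve_left hz']

lemma equalCovecCond_exWeb {z : M4} (hz : z ∈ dom) : EqualCovecCond exWeb z := by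
  refine ⟨by rw [covec_exWeb hz, covec_exWeb hz], fun v hv => ?_⟩
  simp [eq_zero_of_omega_exWeb hz hv]

/-! ### The curvature tensor -/

lemma hasFDerivAt_connNum_apply (j : Fin 2) (z Y : M4) :
    HasFDerivAt (fun w => connNum j w Y)
      (![(Y.1 1 - Y.2 1) • (dX 0 - dY 0) - (Y.1 0 + Y.2 0) • (dX 1 + dY 1),
        (Y.1 1 + Y.2 1) • (dX 0 + dY 0) - (Y.1 0 - Y.2 0) • (dX 1 - dY 1)] j : M4 →L[ℝ] ℝ) z := by
  fin_cases j
  · exact (((hasFDerivAt_x 0 z).sub (hasFDerivAt_y 0 z)).mul_const _).sub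
      (((hasFDerivAt_x 1 z).add (hasFDerivAt_y 1 z)).mul_const _)
  · exact (((hasFDerivAt_x 0 z).add (hasFDerivAt_y 0 z)).mul_const _).sub
      (((hasFDerivAt_x 1 z).sub (hasFDerivAt_y 1 z)).mul_const _)

lemma differentiable_connNum (j : Fin 2) : Differentiable ℝ (connNum j) := by
  fin_cases j
  · simp only [connNum, Fin.zero_eta, Matrix.cons_val_zero]; unfold connNum₀; fun_prop
  · simp only [connNum, Fin.mk_one, Matrix.cons_val_one, Matrix.cons_val_zero]
    unfold connNum₁; fun_prop

lemma fderiv_conn_exWeb_zero {z : M4} (hz : z ∈ dom) (j : Fin 2) (X Y : M4) :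
    fderiv ℝ (conn exWeb 0 j) z X Y =
      (2 * dlt z)⁻¹ * fderiv ℝ (fun w => connNum j w Y) z X
        - (2 * dlt z ^ 2)⁻¹ * (dDlt z X * connNum j z Y) := by
  have hz' : dlt z ≠ 0 := hz
  have he : conn exWeb 0 j =ᶠ[𝓝 z] fun w => (2 * dlt w)⁻¹ • connNum j w := by
    filter_upwards [isOpen_dom.mem_nhds hz] with w hw
    rw [conn_exWeb_zero hw]
  have hK : HasFDerivAt (connNum j) (fderiv ℝ (connNum j) z) z :=
    (differentiable_connNum j z).hasFDerivAt
  have hY := (hK.clm_apply (hasFDerivAt_const Y z)).fderiv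
  have h := ((hasDerivAt_inv (mul_ne_zero two_ne_zero hz')).comp_hasFDerivAt z
    ((hasFDerivAt_dlt z).const_mul 2)).smul hK
  have h' : fderiv ℝ (fun w => (2 * dlt w)⁻¹ • connNum j w) z = _ := h.fderiv
  rw [he.fderiv_eq, h', hY]
  simp
  field_simp
  ring

lemma dForm_neg (α : M4 → M4 →L[ℝ] ℝ) (z X Y : M4) :
    dForm (fun w => -α w) z X Y = -dForm α z X Y := by
  simp [dForm, fderiv_fun_neg]; ring

lemma curv_exWeb_one (j k l : Fin 2) (z : M4) : curv exWeb 1 j k l z = -curv exWeb 0 j k l z := by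
  have h : conn exWeb 1 j = fun w => -conn exWeb 0 j w := funext fun w => conn_exWeb_one j w
  simp only [curv, curvForm, h, dForm_neg, Fin.sum_univ_two, conn_exWeb_one]
  simp
  ring

/-- The numerators `2δ² Γ¹ⱼₖ` of the connection coefficients of the example. -/
def gamNum (z : M4) : Matrix (Fin 2) (Fin 2) ℝ := !![exWeb z 1, rho z; -rho z, -exWeb z 0]

lemma connNum_frame1 {z : M4} (hz : z ∈ dom) (j k : Fin 2) :
    connNum j z (frame1 exWeb k z) = gamNum z k j / dlt z := by
  have hz' : dlt z ≠ 0 := hz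
  fin_cases j <;> fin_cases k <;>
    simp [connNum, connNum₀, connNum₁, gamNum, frame1_exWeb_zero hz, frame1_exWeb_one hz, exWeb,
      rho] <;> field_simp <;> ring

lemma connNum_frame2 {z : M4} (hz : z ∈ dom) (j k : Fin 2) :
    connNum j z (frame2 exWeb k z) = gamNum z j k / dlt z := by
  have hz' : dlt z ≠ 0 := hz
  fin_cases j <;> fin_cases k <;>
    simp [connNum, connNum₀, connNum₁, gamNum, frame2_exWeb_zero hz, frame2_exWeb_one hz, exWeb,
      rho] <;> field_simp <;> ring

lemma dDlt_frame1 {z : M4} (hz : z ∈ dom) (k : Fin 2) : dDlt z (frame1 exWeb k z) =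
    ![2 * (z.2 0 * z.2 1) - sigm z, 2 * (z.2 0 * z.2 1) + sigm z] k / (2 * dlt z) := by
  have hz' : dlt z ≠ 0 := hz
  fin_cases k <;> simp [dDlt, frame1_exWeb_zero hz, frame1_exWeb_one hz, sigm] <;> field_simp <;>
    ring

lemma dDlt_frame2 {z : M4} (hz : z ∈ dom) (k : Fin 2) : dDlt z (frame2 exWeb k z) =
    -![2 * (z.1 0 * z.1 1) + sigm z, 2 * (z.1 0 * z.1 1) - sigm z] k / (2 * dlt z) := by
  have hz' : dlt z ≠ 0 := hz
  fin_cases k <;> simp [dDlt, frame2_exWeb_zero hz, frame2_exWeb_one hz, sigm] <;> field_simp <;>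
    ring

/-- The exterior derivative of the numerator K = `connNum j` has no dx ∧ dy part. Of d(K/2δ), only
-dδ ∧ K/(2δ²) contributes to the curvature. -/
lemma fderiv_connNum_frame (j k l : Fin 2) (z : M4) :
    fderiv ℝ (fun w => connNum j w (frame2 exWeb l z)) z (frame1 exWeb k z) =
      fderiv ℝ (fun w => connNum j w (frame1 exWeb k z)) z (frame2 exWeb l z) := by
  rw [(hasFDerivAt_connNum_apply j z _).fderiv, (hasFDerivAt_connNum_apply j z _).fderiv]
  fin_cases j <;> simp [frame1, frame2] <;> ring

/-- The curvature tensor of the example. -/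
lemma curv_exWeb_zero {z : M4} (hz : z ∈ dom) (j k l : Fin 2) : curv exWeb 0 j k l z =
    (gamNum z k 0 * gamNum z 1 l - gamNum z 0 l * gamNum z k 1
      - ![2 * (z.2 0 * z.2 1) - sigm z, 2 * (z.2 0 * z.2 1) + sigm z] k * gamNum z j l
      - ![2 * (z.1 0 * z.1 1) + sigm z, 2 * (z.1 0 * z.1 1) - sigm z] l * gamNum z k j)
      / (4 * dlt z ^ 4) := by
  have hz' : dlt z ≠ 0 := hz
  simp only [curv, curvForm, dForm, fderiv_conn_exWeb_zero hz, fderiv_connNum_frame j k l z,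
    Fin.sum_univ_two, conn_exWeb_one, conn_exWeb_zero hz, neg_apply, smul_apply, smul_eq_mul,
    connNum_frame1 hz, connNum_frame2 hz, dDlt_frame1 hz, dDlt_frame2 hz]
  fin_cases j <;> simp <;> field_simp <;> ring

lemma curvSym_exWeb_diag (i j : Fin 2) (z : M4) :
    curvSym exWeb i j j j z = curv exWeb i j j j z := by
  simp only [curvSym, sym3]; ring

lemma hexagonalCond_exWeb {z : M4} (hz : z ∈ dom) : HexagonalCond exWeb z := by
  have hz' : dlt z ≠ 0 := hz
  have h : -curv exWeb 0 0 0 0 z + 3 * (curvSym exWeb 0 0 0 1 z - curvSym exWeb 0 0 1 1 z)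
      + curv exWeb 0 1 1 1 z = 0 := by
    simp only [curvSym, sym3, curv_exWeb_zero hz]
    simp [gamNum]
    field_simp
    simp [exWeb, rho, sigm]
    ring
  intro i
  fin_cases i
  · exact h
  · simp only [curvSym, sym3, curv_exWeb_one, Fin.mk_one] at h ⊢
    linarith

lemma not_curvSymIsTrace_exWeb {z : M4} (hz : z ∈ domN) : ¬ CurvSymIsTrace exWeb z := by
  rintro ⟨c, hc⟩
  obtain ⟨hz1, hr, hs⟩ := hz
  have hzd : z ∈ dom := hz1
  -- With three equal lower indices different from the upper one, the trace side vanishes.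
  have h1 := hc 1 0 0 0
  have h2 := hc 0 1 1 1
  rw [curvSym_exWeb_diag, curv_exWeb_one, curv_exWeb_zero hzd] at h1
  rw [curvSym_exWeb_diag, curv_exWeb_zero hzd] at h2
  simp [gamNum, sym3, hz1] at h1 h2
  have k1 : rho z * exWeb z 1 = 0 := by
    simp only [rho] at h1 ⊢
    linear_combination (-1 / 4) * h1
  have k2 : rho z * exWeb z 0 = 0 := by
    simp only [rho] at h2 ⊢
    linear_combination (1 / 4) * h2
  have e1 := (mul_eq_zero.1 k1).resolve_left hr
  have e2 := (mul_eq_zero.1 k2).resolve_left hr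
  -- Here f¹ = f² = 0, while f² - f¹ = 2σ.
  apply hs
  simp [exWeb, -mul_eq_zero] at e1 e2
  simp only [sigm]
  linarith

/-! ### The transversal distribution -/

lemma domA_subset_dom : domA ⊆ dom := fun _ hz => hz.1

lemma isOpen_domA : IsOpen domA :=
  isOpen_dom.inter (isOpen_ne_fun continuous_rho continuous_const)

lemma mem_aDist_exWeb {z : M4} (hz : z ∈ domA) (v : M4) : v ∈ aDist exWeb z ↔
    omega1 exWeb 0 z v + omega1 exWeb 1 z v = 0 ∧
      omega2 exWeb 0 z v + omega2 exWeb 1 z v = 0 := by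
  have hc : -rho z / dlt z ^ 2 ≠ 0 := div_ne_zero (neg_ne_zero.2 hz.2) (pow_ne_zero 2 hz.1)
  simp only [aDist, Submodule.mem_inf, LinearMap.mem_ker, ContinuousLinearMap.coe_coe,
    Fin.sum_univ_two, covec_exWeb (domA_subset_dom hz), add_apply, smul_apply, smul_eq_mul,
    ← mul_add, mul_eq_zero, hc, false_or]

/-- The two equations are d(x¹x²) = 0 and d(y¹y²) = 0. -/
lemma mem_aDist_exWeb_iff {z : M4} (hz : z ∈ domA) (v : M4) : v ∈ aDist exWeb z ↔
    z.1 1 * v.1 0 + z.1 0 * v.1 1 = 0 ∧ z.2 1 * v.2 0 + z.2 0 * v.2 1 = 0 := by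
  rw [mem_aDist_exWeb hz, omega1_exWeb_zero, omega1_exWeb_one, omega2_exWeb_zero,
    omega2_exWeb_one]
  constructor <;> rintro ⟨h1, h2⟩ <;> constructor <;> linarith

/-- The field `x¹∂₁ - x²∂₂` of the plane `x`, which spans `Δ` together with its analogue in the
plane `y`. -/
def hypX (z : M4) : M4 := (![z.1 0, -z.1 1], 0)

/-- The field `y¹∂₁ - y²∂₂` of the plane `y`. -/
def hypY (z : M4) : M4 := (0, ![z.2 0, -z.2 1])

lemma hypX_mem_aDist {z : M4} (hz : z ∈ domA) : hypX z ∈ aDist exWeb z := by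
  rw [mem_aDist_exWeb_iff hz]; constructor <;> simp [hypX]; ring

lemma hypY_mem_aDist {z : M4} (hz : z ∈ domA) : hypY z ∈ aDist exWeb z := by
  rw [mem_aDist_exWeb_iff hz]; constructor <;> simp [hypY]; ring

lemma exists_smul_of_orthogonal {p q u w : ℝ} (h : p ≠ 0 ∨ q ≠ 0) (huw : q * u + p * w = 0) :
    ∃ t : ℝ, u = t * p ∧ w = t * -q := by
  rcases h with h | h
  · exact ⟨u / p, by field_simp, by field_simp; linarith⟩
  · exact ⟨-w / q, by field_simp; linarith, by field_simp⟩

lemma exists_smul_add_of_mem_aDist {z : M4} (hz : z ∈ domA) {v : M4} (hv : v ∈ aDist exWeb z) :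
    ∃ s t : ℝ, v = s • hypX z + t • hypY z := by
  have hd : dlt z ≠ 0 := hz.1
  rw [mem_aDist_exWeb_iff hz] at hv
  have hx : z.1 0 ≠ 0 ∨ z.1 1 ≠ 0 := by
    by_contra! h; exact hd (by simp [dlt, h.1, h.2])
  have hy : z.2 0 ≠ 0 ∨ z.2 1 ≠ 0 := by
    by_contra! h; exact hd (by simp [dlt, h.1, h.2])
  obtain ⟨s, hs0, hs1⟩ := exists_smul_of_orthogonal hx hv.1
  obtain ⟨t, ht0, ht1⟩ := exists_smul_of_orthogonal hy hv.2
  refine ⟨s, t, Prod.ext (funext fun l => ?_) (funext fun l => ?_)⟩ <;> fin_cases l <;>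
    simp [hypX, hypY, hs0, hs1, ht0, ht1]

lemma dlt_eq_zero_of_hypX {z : M4} (h : hypX z = 0) : dlt z = 0 := by
  have h0 := congrFun (congrArg Prod.fst h) 0
  have h1 := congrFun (congrArg Prod.fst h) 1
  simp [hypX] at h0 h1
  simp [dlt, h0, h1]

lemma dlt_eq_zero_of_hypY {z : M4} (h : hypY z = 0) : dlt z = 0 := by
  have h0 := congrFun (congrArg Prod.snd h) 0
  have h1 := congrFun (congrArg Prod.snd h) 1
  simp [hypY] at h0 h1
  simp [dlt, h0, h1]

/-- The integral surface `(x¹eˢ, x²e⁻ˢ, y¹eᵗ, y²e⁻ᵗ)` of `Δ` through the point `(x, y)`. -/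
noncomputable def hypSurface (z : M4) (s : ℝ × ℝ) : M4 :=
  (![z.1 0 * Real.exp s.1, z.1 1 * Real.exp (-s.1)],
    ![z.2 0 * Real.exp s.2, z.2 1 * Real.exp (-s.2)])

lemma hypSurface_zero (z : M4) : hypSurface z 0 = z := by
  refine Prod.ext (funext fun l => ?_) (funext fun l => ?_) <;> fin_cases l <;> simp [hypSurface]

lemma contDiff_hypSurface (z : M4) : ContDiff ℝ ∞ (hypSurface z) := by
  refine ContDiff.prodMk ?_ ?_ <;> rw [contDiff_pi] <;> intro i <;> fin_cases i <;> simp <;>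
    fun_prop

lemma fderiv_hypSurface (z : M4) (s v : ℝ × ℝ) : fderiv ℝ (hypSurface z) s v =
    v.1 • hypX (hypSurface z s) + v.2 • hypY (hypSurface z s) := by
  have hD : DifferentiableAt ℝ (hypSurface z) s :=
    ((contDiff_hypSurface z).differentiable (by simp)) s
  have e1 : HasFDerivAt (fun s : ℝ × ℝ => Real.exp s.1) _ s := hasFDerivAt_fst.exp
  have e2 : HasFDerivAt (fun s : ℝ × ℝ => Real.exp (-s.1)) _ s := hasFDerivAt_fst.neg.exp
  have e3 : HasFDerivAt (fun s : ℝ × ℝ => Real.exp s.2) _ s := hasFDerivAt_snd.exp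
  have e4 : HasFDerivAt (fun s : ℝ × ℝ => Real.exp (-s.2)) _ s := hasFDerivAt_snd.neg.exp
  have hx (i : Fin 2) := (dX i).hasFDerivAt.comp s hD.hasFDerivAt
  have hy (i : Fin 2) := (dY i).hasFDerivAt.comp s hD.hasFDerivAt
  have k1 := congrArg (fun L => L v) ((hx 0).unique (e1.const_mul (z.1 0)))
  have k2 := congrArg (fun L => L v) ((hx 1).unique (e2.const_mul (z.1 1)))
  have k3 := congrArg (fun L => L v) ((hy 0).unique (e3.const_mul (z.2 0)))
  have k4 := congrArg (fun L => L v) ((hy 1).unique (e4.const_mul (z.2 1)))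
  refine Prod.ext (funext fun l => ?_) (funext fun l => ?_) <;> fin_cases l
  · simp at k1; simp [k1, hypX, hypY, hypSurface]; ring
  · simp at k2; simp [k2, hypX, hypY, hypSurface]; ring
  · simp at k3; simp [k3, hypX, hypY, hypSurface]; ring
  · simp at k4; simp [k4, hypX, hypY, hypSurface]; ring

lemma smul_hypX_add_smul_hypY_eq_zero {z : M4} (hz : z ∈ dom) {s t : ℝ}
    (h : s • hypX z + t • hypY z = 0) : s = 0 ∧ t = 0 := by
  have h1 := congrArg Prod.fst h
  have h2 := congrArg Prod.snd h
  constructor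
  · by_contra hs
    have : hypX z = 0 := (smul_eq_zero.1 (Prod.ext (by simpa [hypY] using h1)
      (by simp [hypX]) : s • hypX z = 0)).resolve_left hs
    exact hz (dlt_eq_zero_of_hypX this)
  · by_contra ht
    have : hypY z = 0 := (smul_eq_zero.1 (Prod.ext (by simp [hypY])
      (by simpa [hypX] using h2) : t • hypY z = 0)).resolve_left ht
    exact hz (dlt_eq_zero_of_hypY this)

lemma isIntegrableOn_aDist_exWeb : IsIntegrableOn (aDist exWeb) domA := by
  intro z hz
  -- Along the surface ρ is constant but δ may vanish, so the parameter domain is cut down.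
  have hO : IsOpen (hypSurface z ⁻¹' domA) := isOpen_domA.preimage (contDiff_hypSurface z).continuous
  refine ⟨hypSurface z ⁻¹' domA, hypSurface z, by simpa [hypSurface_zero] using hz,
    hypSurface_zero z, fun s hs => hs, ⟨hO, (contDiff_hypSurface z).contDiffOn, fun s hs => ?_⟩,
    fun s hs => ?_⟩
  · rw [injective_iff_map_eq_zero]
    intro v hv
    rw [fderiv_hypSurface] at hv
    obtain ⟨h1, h2⟩ := smul_hypX_add_smul_hypY_eq_zero (domA_subset_dom hs) hv
    exact Prod.ext h1 h2
  · ext v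
    constructor
    · rintro ⟨u, rfl⟩
      rw [ContinuousLinearMap.coe_coe, fderiv_hypSurface]
      exact add_mem (Submodule.smul_mem _ _ (hypX_mem_aDist hs))
        (Submodule.smul_mem _ _ (hypY_mem_aDist hs))
    · intro hv
      obtain ⟨s', t', rfl⟩ := exists_smul_add_of_mem_aDist hs hv
      exact ⟨(s', t'), fderiv_hypSurface z s _⟩

/-! ### Geodesic parallelism of the distribution -/

/-- Both the connection and the torsion change sign with the upper index, so P and Q play no role.
Consequently X¹ + X² = 0 implies (∇X)¹ + (∇X)² = 0, which is the parallelism of Δ. -/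
lemma theta_exWeb_add (P Q : M4 → ℝ) (j : Fin 2) (z : M4) :
    theta exWeb P Q 0 j z + theta exWeb P Q 1 j z = 0 := by
  simp only [theta, conn_exWeb_one, torsion_exWeb_one, Fin.sum_univ_two]
  module

lemma differentiable_fderiv_exWeb (i : Fin 2) : Differentiable ℝ (fderiv ℝ fun w => exWeb w i) := by
  have h : ContDiff ℝ 2 fun w => exWeb w i := contDiff_infty.1 ((contDiff_pi.1 contDiff_exWeb) i) 2
  exact (h.fderiv_right (m := 1) (by norm_num)).differentiable one_ne_zero

lemma isGeodesicallyParallelOn_exWeb (P Q : M4 → ℝ) :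
    IsGeodesicallyParallelOn exWeb P Q (aDist exWeb) domA := by
  intro z hz X hX hXD v
  have hz' : dlt z ≠ 0 := hz.1
  have hzd : z ∈ dom := hz.1
  have hX1 (i : Fin 2) : DifferentiableAt ℝ (fun w => omega1 exWeb i w (X w)) z := by
    have := differentiable_fderiv_exWeb i z
    unfold omega1
    fun_prop
  have hX2 (i : Fin 2) : DifferentiableAt ℝ (fun w => omega2 exWeb i w (X w)) z := by
    have := differentiable_fderiv_exWeb i z
    unfold omega2
    fun_prop
  have hev : ∀ᶠ w in 𝓝 z, w ∈ domA ∧ X w ∈ aDist exWeb w :=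
    (isOpen_domA.eventually_mem hz).and hXD
  have d1 : fderiv ℝ (fun w => omega1 exWeb 0 w (X w)) z v
      + fderiv ℝ (fun w => omega1 exWeb 1 w (X w)) z v = 0 := by
    have he : (fun w => omega1 exWeb 0 w (X w) + omega1 exWeb 1 w (X w)) =ᶠ[𝓝 z] fun _ => 0 := by
      filter_upwards [hev] with w hw using ((mem_aDist_exWeb hw.1 _).1 hw.2).1
    have h := he.fderiv_eq (𝕜 := ℝ)
    rw [fderiv_fun_add (hX1 0) (hX1 1)] at h
    simpa using congrArg (fun L => L v) h
  have d2 : fderiv ℝ (fun w => omega2 exWeb 0 w (X w)) z v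
      + fderiv ℝ (fun w => omega2 exWeb 1 w (X w)) z v = 0 := by
    have he : (fun w => omega2 exWeb 0 w (X w) + omega2 exWeb 1 w (X w)) =ᶠ[𝓝 z] fun _ => 0 := by
      filter_upwards [hev] with w hw using ((mem_aDist_exWeb hw.1 _).1 hw.2).2
    have h := he.fderiv_eq (𝕜 := ℝ)
    rw [fderiv_fun_add (hX2 0) (hX2 1)] at h
    simpa using congrArg (fun L => L v) h
  have t0 : theta exWeb P Q 1 0 z v = -theta exWeb P Q 0 0 z v := by
    have := congrArg (fun L => L v) (theta_exWeb_add P Q 0 z)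
    simp at this; linarith
  have t1 : theta exWeb P Q 1 1 z v = -theta exWeb P Q 0 1 z v := by
    have := congrArg (fun L => L v) (theta_exWeb_add P Q 1 z)
    simp at this; linarith
  -- Vectors whose components of index `1` are minus those of index `0` lie in Δ; ∇X is of this
  -- shape.
  have key (α β : ℝ) : α • (frame1 exWeb 0 z - frame1 exWeb 1 z)
      + β • (frame2 exWeb 0 z - frame2 exWeb 1 z) ∈ aDist exWeb z := by
    rw [mem_aDist_exWeb_iff hz]
    constructor <;> simp [frame1_exWeb_zero hzd, frame1_exWeb_one hzd, frame2_exWeb_zero hzd,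
      frame2_exWeb_one hzd] <;> field_simp <;> ring
  convert key (fderiv ℝ (fun w => omega1 exWeb 0 w (X w)) z v
      + ∑ j, theta exWeb P Q 0 j z v * omega1 exWeb j z (X z))
    (fderiv ℝ (fun w => omega2 exWeb 0 w (X w)) z v
      + ∑ j, theta exWeb P Q 0 j z v * omega2 exWeb j z (X z)) using 1
  rw [covDeriv]
  simp only [Fin.sum_univ_two, t0, t1, eq_neg_of_add_eq_zero_right d1,
    eq_neg_of_add_eq_zero_right d2]
  module

/-! ### The planar webs cut on the integral surfaces -/

lemma finrank_ker_eq_one_of_forall_mem_iff {T : ℝ × ℝ →L[ℝ] V2} {w : ℝ × ℝ} (hw : w ≠ 0)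
    (h : ∀ v, T v = 0 ↔ ∃ t : ℝ, t • w = v) :
    Module.finrank ℝ (LinearMap.ker T.toLinearMap) = 1 := by
  have : LinearMap.ker T.toLinearMap = Submodule.span ℝ {w} := by
    ext v
    rw [Submodule.mem_span_singleton, ← h]
    rfl
  rw [this, finrank_span_singleton hw]

/-- Both fields annihilate f¹ + f², and they map σ to δ and -δ respectively. Hence f = const has
direction s = t in Δ. -/
lemma fderiv_exWeb_hyp (z : M4) (i : Fin 2) (s t : ℝ) :
    fderiv ℝ (fun w => exWeb w i) z (s • hypX z + t • hypY z) =
      ![(t - s) * dlt z, (s - t) * dlt z] i := by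
  fin_cases i
  · simp [fderiv_exWeb_zero, hypX, hypY, dlt]; ring
  · simp [fderiv_exWeb_one, hypX, hypY, dlt]; ring

lemma isPlanarWeb_of_isIntegralSurface {O : Set (ℝ × ℝ)} {φ : ℝ × ℝ → M4}
    (hm : Set.MapsTo φ O domA) (hφ : IsIntegralSurface (aDist exWeb) O φ) :
    IsPlanarWeb (fun s => (φ s).1) (fun s => (φ s).2) (fun s => exWeb (φ s)) O := by
  obtain ⟨⟨hO, hc, hinj⟩, ht⟩ := hφ
  refine ⟨hc.fst, hc.snd, contDiff_exWeb.comp_contDiffOn hc, fun s hs => ?_⟩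
  have hz : φ s ∈ domA := hm hs
  have hd : dlt (φ s) ≠ 0 := hz.1
  have hD : HasFDerivAt φ (fderiv ℝ φ s) s :=
    ((hc.differentiableOn (by simp)).differentiableAt (hO.mem_nhds hs)).hasFDerivAt
  obtain ⟨u, hu⟩ : hypX (φ s) ∈ tangentPlane φ s := by rw [ht s hs]; exact hypX_mem_aDist hz
  obtain ⟨w, hw⟩ : hypY (φ s) ∈ tangentPlane φ s := by rw [ht s hs]; exact hypY_mem_aDist hz
  rw [ContinuousLinearMap.coe_coe] at hu hw
  have hcomb (α β : ℝ) : fderiv ℝ φ s (α • u + β • w) = α • hypX (φ s) + β • hypY (φ s) := by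
    simp [hu, hw]
  have hspan (v : ℝ × ℝ) : ∃ α β : ℝ, v = α • u + β • w := by
    have hv : fderiv ℝ φ s v ∈ aDist exWeb (φ s) := by rw [← ht s hs]; exact ⟨v, rfl⟩
    obtain ⟨α, β, h⟩ := exists_smul_add_of_mem_aDist hz hv
    exact ⟨α, β, hinj s hs (h.trans (hcomb α β).symm)⟩
  have hind {α β : ℝ} (h : α • u + β • w = 0) : α = 0 ∧ β = 0 :=
    smul_hypX_add_smul_hypY_eq_zero hz.1 (by rw [← hcomb, h, map_zero])
  have hX : (hypX (φ s)).1 ≠ 0 := fun h => hd (dlt_eq_zero_of_hypX (Prod.ext h rfl))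
  have hY : (hypY (φ s)).2 ≠ 0 := fun h => hd (dlt_eq_zero_of_hypY (Prod.ext rfl h))
  have h1 (α β : ℝ) : fderiv ℝ (fun s => (φ s).1) s (α • u + β • w) = 0 ↔ α = 0 := by
    rw [hD.fst.fderiv, ContinuousLinearMap.comp_apply, hcomb]
    simp [hypY, hX]
  have h2 (α β : ℝ) : fderiv ℝ (fun s => (φ s).2) s (α • u + β • w) = 0 ↔ β = 0 := by
    rw [hD.snd.fderiv, ContinuousLinearMap.comp_apply, hcomb]
    simp [hypX, hY]
  have h3 (α β : ℝ) : fderiv ℝ (fun s => exWeb (φ s)) s (α • u + β • w) = 0 ↔ α = β := by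
    have hF : HasFDerivAt (fun s => exWeb (φ s)) _ s := hasFDerivAt_pi.2 fun i =>
      (((contDiff_pi.1 contDiff_exWeb i).differentiable (by simp)) (φ s)).hasFDerivAt.comp s hD
    rw [hF.fderiv]
    constructor
    · intro h
      have h0 := congrFun h 0
      rw [ContinuousLinearMap.pi_apply, ContinuousLinearMap.comp_apply, hcomb,
        fderiv_exWeb_hyp] at h0
      simp [hd] at h0
      linarith
    · rintro rfl
      funext i
      rw [ContinuousLinearMap.pi_apply, ContinuousLinearMap.comp_apply, hcomb, fderiv_exWeb_hyp]
      fin_cases i <;> simp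
  have hu0 : u ≠ 0 := fun h => one_ne_zero (hind (α := 1) (β := 0) (by simp [h])).1
  have hw0 : w ≠ 0 := fun h => one_ne_zero (hind (α := 0) (β := 1) (by simp [h])).2
  have huw0 : u + w ≠ 0 := fun h => one_ne_zero (hind (α := 1) (β := 1) (by simp [h])).1
  refine ⟨finrank_ker_eq_one_of_forall_mem_iff hw0 fun v => ⟨fun hv => ?_, ?_⟩,
    finrank_ker_eq_one_of_forall_mem_iff hu0 fun v => ⟨fun hv => ?_, ?_⟩,
    finrank_ker_eq_one_of_forall_mem_iff huw0 fun v => ⟨fun hv => ?_, ?_⟩, ?_, ?_, ?_⟩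
  · obtain ⟨α, β, rfl⟩ := hspan v
    exact ⟨β, by simp [(h1 α β).1 hv]⟩
  · rintro ⟨t, rfl⟩
    simpa using (h1 0 t).2 rfl
  · obtain ⟨α, β, rfl⟩ := hspan v
    exact ⟨α, by simp [(h2 α β).1 hv]⟩
  · rintro ⟨t, rfl⟩
    simpa using (h2 t 0).2 rfl
  · obtain ⟨α, β, rfl⟩ := hspan v
    exact ⟨α, by simp [(h3 α β).1 hv]⟩
  · rintro ⟨t, rfl⟩
    simpa using (h3 t t).2 rfl
  all_goals
    rw [Submodule.eq_bot_iff]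
    rintro v ⟨hv, hv'⟩
    obtain ⟨α, β, rfl⟩ := hspan v
  · simp [(h1 α β).1 hv, (h2 α β).1 hv']
  · simp [← (h3 α β).1 hv', (h1 α β).1 hv]
  · simp [(h3 α β).1 hv', (h2 α β).1 hv]

/-- Hexagons close in a web which is described by nonvanishing functions `x`, `y`, `xy`. -/
lemma hexagonsClose_of_mul {h₁ h₂ h₃ : ℝ × ℝ → V2} {N : Set (ℝ × ℝ)} (x y : ℝ × ℝ → ℝ)
    (hx : ∀ P ∈ N, x P ≠ 0) (hy : ∀ P ∈ N, y P ≠ 0)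
    (e₁ : ∀ P ∈ N, ∀ Q ∈ N, h₁ P = h₁ Q → x P = x Q)
    (e₂ : ∀ P ∈ N, ∀ Q ∈ N, h₂ P = h₂ Q ↔ y P = y Q)
    (e₃ : ∀ P ∈ N, ∀ Q ∈ N, h₃ P = h₃ Q → x P * y P = x Q * y Q) :
    HexagonsClose h₁ h₂ h₃ N := by
  intro P₀ m₀ P₁ m₁ P₂ m₂ P₃ m₃ P₄ m₄ P₅ m₅ P₆ m₆ a₁ a₄ b₂ b₅ c₃ c₆ c₁₂ a₂₃ b₃₄ c₄₅ a₅₆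
  rw [e₂ _ m₆ _ m₁]
  have x1 := e₁ _ m₁ _ m₀ a₁
  have x4 := e₁ _ m₄ _ m₀ a₄
  have y2 := (e₂ _ m₂ _ m₀).1 b₂
  have y5 := (e₂ _ m₅ _ m₀).1 b₅
  have c3 := e₃ _ m₃ _ m₀ c₃
  have c6 := e₃ _ m₆ _ m₀ c₆
  have c12 := e₃ _ m₁ _ m₂ c₁₂
  have x23 := e₁ _ m₂ _ m₃ a₂₃
  have y34 := (e₂ _ m₃ _ m₄).1 b₃₄
  have c45 := e₃ _ m₄ _ m₅ c₄₅
  have x56 := e₁ _ m₅ _ m₆ a₅₆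
  rw [x1, y2, x23] at c12
  rw [y34] at c3
  rw [x4, y5, x56] at c45
  have hy0 := hy _ m₀
  have hx0 := hx _ m₀
  have hx3 := hx _ m₃
  have hx6 := hx _ m₆
  -- In the coordinates log|x|, log|y| this says that P₃ and P₆ are symmetric about the centre.
  have h36 : x P₃ * x P₆ = x P₀ * x P₀ := by
    apply mul_right_cancel₀ hy0
    linear_combination (-x P₃) * c45 + x P₀ * c3
  apply mul_left_cancel₀ hx6
  rw [c6]
  apply mul_left_cancel₀ hx0
  linear_combination (-x P₆) * c12 - y P₀ * h36

/-- The differentials of x¹x² and y¹y² vanish on Δ. A ball is used because constancy needs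
connectedness and `O` may be disconnected. -/
lemma apply_eq_of_mem_ball {O : Set (ℝ × ℝ)} {φ : ℝ × ℝ → M4}
    (hm : Set.MapsTo φ O domA) (hφ : IsIntegralSurface (aDist exWeb) O φ) {s : ℝ × ℝ} {ε : ℝ}
    (hε : Metric.ball s ε ⊆ O) {P Q : ℝ × ℝ} (hP : P ∈ Metric.ball s ε)
    (hQ : Q ∈ Metric.ball s ε) :
    (φ P).1 0 * (φ P).1 1 = (φ Q).1 0 * (φ Q).1 1 ∧
      (φ P).2 0 * (φ P).2 1 = (φ Q).2 0 * (φ Q).2 1 := by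
  obtain ⟨⟨hO, hc, hinj⟩, ht⟩ := hφ
  have hD (t) (h : t ∈ Metric.ball s ε) : HasFDerivAt φ (fderiv ℝ φ t) t :=
    ((hc.differentiableOn (by simp)).differentiableAt (hO.mem_nhds (hε h))).hasFDerivAt
  have hx (i : Fin 2) (t) (h : t ∈ Metric.ball s ε) :
      HasFDerivAt (fun t => (φ t).1 i) ((dX i).comp (fderiv ℝ φ t)) t :=
    (hasFDerivAt_x i (φ t)).comp t (hD t h)
  have hy (i : Fin 2) (t) (h : t ∈ Metric.ball s ε) :
      HasFDerivAt (fun t => (φ t).2 i) ((dY i).comp (fderiv ℝ φ t)) t :=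
    (hasFDerivAt_y i (φ t)).comp t (hD t h)
  have hconn : IsPreconnected (Metric.ball s ε) := (convex_ball s ε).isPreconnected
  have hv (t) (h : t ∈ Metric.ball s ε) (v : ℝ × ℝ) :
      (φ t).1 1 * (fderiv ℝ φ t v).1 0 + (φ t).1 0 * (fderiv ℝ φ t v).1 1 = 0 ∧
        (φ t).2 1 * (fderiv ℝ φ t v).2 0 + (φ t).2 0 * (fderiv ℝ φ t v).2 1 = 0 :=
    (mem_aDist_exWeb_iff (hm (hε h)) _).1 (by rw [← ht t (hε h)]; exact ⟨v, rfl⟩)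
  constructor
  · have h (t : ℝ × ℝ) (h : t ∈ Metric.ball s ε) :
        HasFDerivAt (fun t => (φ t).1 0 * (φ t).1 1) (0 : ℝ × ℝ →L[ℝ] ℝ) t := by
      refine ((hx 0 t h).mul (hx 1 t h)).congr_fderiv ?_
      refine ContinuousLinearMap.ext fun v => ?_
      have := (hv t h v).1
      simp
      linarith
    exact Metric.isOpen_ball.is_const_of_fderiv_eq_zero hconn
      (fun t ht => (h t ht).differentiableAt.differentiableWithinAt)
      (fun t ht => (h t ht).fderiv) hP hQ
  · have h (t : ℝ × ℝ) (h : t ∈ Metric.ball s ε) :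
        HasFDerivAt (fun t => (φ t).2 0 * (φ t).2 1) (0 : ℝ × ℝ →L[ℝ] ℝ) t := by
      refine ((hy 0 t h).mul (hy 1 t h)).congr_fderiv ?_
      refine ContinuousLinearMap.ext fun v => ?_
      have := (hv t h v).2
      simp
      linarith
    exact Metric.isOpen_ball.is_const_of_fderiv_eq_zero hconn
      (fun t ht => (h t ht).differentiableAt.differentiableWithinAt)
      (fun t ht => (h t ht).fderiv) hP hQ

lemma cutsHexagonalWeb_of_isIntegralSurface {O : Set (ℝ × ℝ)} {φ : ℝ × ℝ → M4}
    (hm : Set.MapsTo φ O domA) (hφ : IsIntegralSurface (aDist exWeb) O φ) :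
    CutsHexagonalWeb exWeb O φ := by
  refine ⟨isPlanarWeb_of_isIntegralSurface hm hφ, fun s hs => ?_⟩
  have hO := hφ.1.1
  have hcs : ContinuousAt φ s := hφ.1.2.1.continuousOn.continuousAt (hO.mem_nhds hs)
  have hd : dlt (φ s) ≠ 0 := (hm hs).1
  have hx (i : Fin 2) : ContinuousAt (fun t => (φ t).1 i) s := by fun_prop
  have hy (i : Fin 2) : ContinuousAt (fun t => (φ t).2 i) s := by fun_prop
  -- A two-point version of δ, equal to δ on the diagonal; it is the cofactor needed in `hprod`.
  have hpair : ∀ᶠ q : (ℝ × ℝ) × (ℝ × ℝ) in 𝓝 s ×ˢ 𝓝 s,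
      (φ q.1).1 0 * (φ q.1).2 1 + (φ q.2).1 1 * (φ q.2).2 0 ≠ 0 := by
    rw [← nhds_prod_eq]
    refine ContinuousAt.eventually_ne ?_ hd
    have hf : Filter.Tendsto Prod.fst (𝓝 (s, s)) (𝓝 s) := continuousAt_fst
    have hg : Filter.Tendsto Prod.snd (𝓝 (s, s)) (𝓝 s) := continuousAt_snd
    exact (((hx 0).tendsto.comp hf).mul ((hy 1).tendsto.comp hf)).add
      (((hx 1).tendsto.comp hg).mul ((hy 0).tendsto.comp hg))
  obtain ⟨S, hS, hSq⟩ := (Filter.eventually_prod_self_iff (r := fun P Q =>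
    (φ P).1 0 * (φ P).2 1 + (φ Q).1 1 * (φ Q).2 0 ≠ 0)).1 hpair
  have hne : (φ s).1 0 ≠ 0 ∧ (φ s).2 1 ≠ 0 ∨ (φ s).1 1 ≠ 0 ∧ (φ s).2 0 ≠ 0 := by
    by_contra! h
    apply hd
    by_cases h0 : (φ s).1 0 = 0 <;> by_cases h1 : (φ s).1 1 = 0 <;> simp_all [dlt]
  have hev (x y : ℝ × ℝ → ℝ) (hx : ContinuousAt x s) (hy : ContinuousAt y s) (hx0 : x s ≠ 0)
      (hy0 : y s ≠ 0) : ∃ ε > 0, ∀ P ∈ Metric.ball s ε, P ∈ O ∧ P ∈ S ∧ x P ≠ 0 ∧ y P ≠ 0 :=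
    Metric.eventually_nhds_iff_ball.1 ((hO.eventually_mem hs).and
      (Filter.Eventually.and hS ((hx.eventually_ne hx0).and (hy.eventually_ne hy0))))
  have hprod {P Q : ℝ × ℝ} {ε : ℝ} (hε : Metric.ball s ε ⊆ O) (hP : P ∈ Metric.ball s ε)
      (hQ : Q ∈ Metric.ball s ε) (hPS : P ∈ S) (hQS : Q ∈ S) (h : exWeb (φ P) = exWeb (φ Q)) :
      (φ P).1 0 * (φ P).2 1 = (φ Q).1 0 * (φ Q).2 1 ∧
        (φ P).1 1 * (φ P).2 0 = (φ Q).1 1 * (φ Q).2 0 := by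
    have h0 := congrFun h 0
    have h1 := congrFun h 1
    simp [exWeb] at h0 h1
    obtain ⟨k1, k2⟩ := apply_eq_of_mem_ball hm hφ hε hP hQ
    -- Put m = x¹y², n = x²y¹. Since mn is constant on the ball, (m_P - m_Q)(m_P + n_Q) = m_P(σ_P -
    -- σ_Q) = 0.
    have e : (φ P).1 0 * (φ P).2 1 = (φ Q).1 0 * (φ Q).2 1 := by
      apply sub_eq_zero.1
      apply (mul_eq_zero.1 (?_ : _ * ((φ P).1 0 * (φ P).2 1 + (φ Q).1 1 * (φ Q).2 0) = 0)).resolve_right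
        (hSq P hPS Q hQS)
      linear_combination (φ P).2 0 * (φ P).2 1 * k1 + (φ Q).1 0 * (φ Q).1 1 * k2 +
        (φ P).1 0 * (φ P).2 1 * (h1 - h0) / 2
    exact ⟨e, by linarith⟩
  rcases hne with ⟨n0, n1⟩ | ⟨n0, n1⟩
  · obtain ⟨ε, hε, hN⟩ := hev _ _ (hx 0) (hy 1) n0 n1
    have hNO : Metric.ball s ε ⊆ O := fun P hP => (hN P hP).1
    refine ⟨Metric.ball s ε, Metric.ball_mem_nhds s hε, hNO, hexagonsClose_of_mul
      (fun t => (φ t).1 0) (fun t => (φ t).2 1) (fun P hP => (hN P hP).2.2.1)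
      (fun P hP => (hN P hP).2.2.2) (fun P _ Q _ h => congrFun h 0)
      -- Conversely, y² ≠ 0 determines y¹ because y¹y² is constant.
      (fun P hP Q hQ => ⟨fun h => congrFun h 1, fun h => ?_⟩) fun P hP Q hQ h => ?_⟩
    · have k := (apply_eq_of_mem_ball hm hφ hNO hP hQ).2
      simp only [h] at k
      funext l
      fin_cases l
      exacts [mul_right_cancel₀ (hN Q hQ).2.2.2 k, h]
    · exact (hprod hNO hP hQ (hN P hP).2.1 (hN Q hQ).2.1 h).1
  · obtain ⟨ε, hε, hN⟩ := hev _ _ (hx 1) (hy 0) n0 n1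
    have hNO : Metric.ball s ε ⊆ O := fun P hP => (hN P hP).1
    refine ⟨Metric.ball s ε, Metric.ball_mem_nhds s hε, hNO, hexagonsClose_of_mul
      (fun t => (φ t).1 1) (fun t => (φ t).2 0) (fun P hP => (hN P hP).2.2.1)
      (fun P hP => (hN P hP).2.2.2) (fun P _ Q _ h => congrFun h 1)
      (fun P hP Q hQ => ⟨fun h => congrFun h 0, fun h => ?_⟩) fun P hP Q hQ h => ?_⟩
    · have k := (apply_eq_of_mem_ball hm hφ hNO hP hQ).2
      simp only [h] at k
      funext l
      fin_cases l
      exacts [h, mul_left_cancel₀ (hN Q hQ).2.2.2 k]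
    · exact (hprod hNO hP hQ (hN P hP).2.1 (hN Q hQ).2.1 h).2

/-! ### Surfaces with transversal tangent planes -/

lemma eq_zero_of_eventually_hasDerivAt {g : ℝ → ℝ} {g' a : ℝ} (hg : ∀ᶠ u in 𝓝 a, g u = 0)
    (h : HasDerivAt g g' a) : g' = 0 :=
  h.unique ((hasDerivAt_const a (0 : ℝ)).congr_of_eventuallyEq hg)

/-- A surface `x² = β(x¹)`, `y² = γ(y¹)` whose tangent planes are transversal, and on which `dx²`
vanishes at a point, satisfies a second order condition at this point. -/
lemma mul_dlt_eq_zero_of_graph {a c : ℝ} {β γ : ℝ → ℝ} (hβ : ContDiffAt ℝ 2 β a)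
    (hγ : ContDiffAt ℝ 2 γ c)
    (hG : ∀ᶠ q : ℝ × ℝ in 𝓝 (a, c),
      β q.1 * (β q.1 + q.1 * deriv β q.1) - γ q.2 * (γ q.2 + q.2 * deriv γ q.2)
        - deriv γ q.2 * (q.1 * (β q.1 + q.1 * deriv β q.1))
        + deriv β q.1 * (q.2 * (γ q.2 + q.2 * deriv γ q.2)) = 0)
    (hp : deriv β a = 0) :
    β a ^ 2 * (β a ^ 2 - γ c ^ 2) * (a * γ c + β a * c) = 0 := by
  have hβ1 : HasDerivAt β 0 a := hp ▸ (hβ.differentiableAt (by simp)).hasDerivAt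
  have hγ1 : HasDerivAt γ (deriv γ c) c := (hγ.differentiableAt (by simp)).hasDerivAt
  have hβ2 : HasDerivAt (deriv β) (deriv (deriv β) a) a :=
    ((hβ.derivWithin (m := 1) (by norm_num)).differentiableAt one_ne_zero).hasDerivAt
  have hγ2 : HasDerivAt (deriv γ) (deriv (deriv γ) c) c :=
    ((hγ.derivWithin (m := 1) (by norm_num)).differentiableAt one_ne_zero).hasDerivAt
  set P := deriv (deriv β) a
  set R := deriv (deriv γ) c
  -- With the variables swapped, currying gives, for each w near c, an identity in u near a. It is
  -- differentiated in u (`hu`) and evaluated (`hw`) at u = a.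
  have hswap : ∀ᶠ q : ℝ × ℝ in 𝓝 (c, a),
      β q.2 * (β q.2 + q.2 * deriv β q.2) - γ q.1 * (γ q.1 + q.1 * deriv γ q.1)
        - deriv γ q.1 * (q.2 * (β q.2 + q.2 * deriv β q.2))
        + deriv β q.2 * (q.1 * (γ q.1 + q.1 * deriv γ q.1)) = 0 :=
    (continuous_swap.tendsto (c, a)).eventually hG
  have hcurry := hswap.curry_nhds
  have hu : ∀ᶠ w in 𝓝 c, a * β a * P - (β a + a ^ 2 * P) * deriv γ w
      + P * (w * (γ w + w * deriv γ w)) = 0 := by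
    filter_upwards [hcurry] with w hw
    have hsum := hβ1.add ((hasDerivAt_id a).mul hβ2)
    have := eq_zero_of_eventually_hasDerivAt hw
      ((((hβ1.mul hsum).sub_const _).sub (((hasDerivAt_id a).mul hsum).const_mul (deriv γ w))).add
        (hβ2.mul_const _))
    simp [hp] at this
    linear_combination this
  have hw : ∀ᶠ w in 𝓝 c, β a ^ 2 - γ w * (γ w + w * deriv γ w) - deriv γ w * (a * β a) = 0 := by
    filter_upwards [hcurry] with w hw
    have := hw.self_of_nhds
    simp only [hp] at this
    linear_combination this
  have e0 := hw.self_of_nhds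
  have e1 := hu.self_of_nhds
  have hsum := hγ1.add ((hasDerivAt_id c).mul hγ2)
  have e2 := eq_zero_of_eventually_hasDerivAt hu
    (((hγ2.const_mul (β a + a ^ 2 * P)).const_sub (a * β a * P)).add
      (((hasDerivAt_id c).mul hsum).const_mul P))
  have e3 := eq_zero_of_eventually_hasDerivAt hw
    (((hγ1.mul hsum).const_sub (β a ^ 2)).sub (hγ2.mul_const (a * β a)))
  simp at e2 e3
  set r := deriv γ c
  set b := β a
  set d := γ c
  -- P is eliminated between `e1` and `e2`, which are linear in it; `e3` then removes R.
  have k : b * r * (d + c * r) = 0 := by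
    linear_combination -(d + 3 * c * r + (c ^ 2 - a ^ 2) * R) / 4 * e1
      + (a * b - a ^ 2 * r + c * d + c ^ 2 * r) / 4 * e2 - b / 4 * e3
  -- By `e0`, r(ab + cd) = b² - d²; this clears r from (ab + cd)² times `k`.
  linear_combination (a * b + c * d) ^ 2 * k
    + b * (d * (a * b + c * d) + c * (b ^ 2 - d ^ 2 + r * (a * b + c * d))) * e0

/-! ### Reparametrization of a surface as a graph. -/

lemma exists_contDiffAt_rightInverse {Φ : ℝ × ℝ → ℝ × ℝ} {s : ℝ × ℝ} (h : ContDiffAt ℝ 2 Φ s)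
    (hs : Function.Surjective (fderiv ℝ Φ s)) :
    ∃ g : ℝ × ℝ → ℝ × ℝ, ContDiffAt ℝ 2 g (Φ s) ∧ g (Φ s) = s ∧
      ∀ᶠ p in 𝓝 (Φ s), Φ (g p) = p := by
  have hi : Function.Injective (fderiv ℝ Φ s).toLinearMap :=
    LinearMap.injective_iff_surjective.2 hs
  let e : (ℝ × ℝ) ≃L[ℝ] (ℝ × ℝ) :=
    (LinearEquiv.ofBijective (fderiv ℝ Φ s).toLinearMap ⟨hi, hs⟩).toContinuousLinearEquiv
  have he : HasFDerivAt Φ (e : (ℝ × ℝ) →L[ℝ] (ℝ × ℝ)) s :=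
    (h.differentiableAt two_ne_zero).hasFDerivAt
  exact ⟨h.localInverse he two_ne_zero, h.to_localInverse he two_ne_zero,
    h.localInverse_apply_image he two_ne_zero,
    (h.hasStrictFDerivAt' he two_ne_zero).eventually_right_inverse⟩

lemma hasDerivAt_mk_left {B : ℝ × ℝ → ℝ} {u w : ℝ} (h : DifferentiableAt ℝ B (u, w)) :
    HasDerivAt (fun t => B (t, w)) (fderiv ℝ B (u, w) (1, 0)) u :=
  h.hasFDerivAt.comp_hasDerivAt u ((hasDerivAt_id u).prodMk (hasDerivAt_const u w))

lemma hasDerivAt_mk_right {B : ℝ × ℝ → ℝ} {u w : ℝ} (h : DifferentiableAt ℝ B (u, w)) :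
    HasDerivAt (fun t => B (u, t)) (fderiv ℝ B (u, w) (0, 1)) w :=
  h.hasFDerivAt.comp_hasDerivAt w ((hasDerivAt_const w u).prodMk (hasDerivAt_id w))

/-- A function of two variables whose second partial derivative vanishes near a point depends
near this point on the first variable only. -/
lemma eventually_eq_of_fderiv_snd_eq_zero {B : ℝ × ℝ → ℝ} {a c : ℝ}
    (h : ∀ᶠ p in 𝓝 (a, c), DifferentiableAt ℝ B p ∧ fderiv ℝ B p (0, 1) = 0) :
    ∀ᶠ p in 𝓝 (a, c), B p = B (p.1, c) ∧
      deriv (fun u => B (u, c)) p.1 = fderiv ℝ B p (1, 0) := by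
  obtain ⟨ε, hε, hB⟩ := Metric.eventually_nhds_iff_ball.1 h
  rw [← ball_prod_same] at hB
  have hconst : ∀ u ∈ Metric.ball a ε, ∀ w ∈ Metric.ball c ε, B (u, w) = B (u, c) := by
    intro u hu w hw
    have hd (t : ℝ) (ht : t ∈ Metric.ball c ε) : HasDerivAt (fun t => B (u, t)) 0 t :=
      (hB (u, t) ⟨hu, ht⟩).2 ▸ hasDerivAt_mk_right (hB (u, t) ⟨hu, ht⟩).1
    exact Metric.isOpen_ball.is_const_of_deriv_eq_zero (convex_ball c ε).isPreconnected
      (fun t ht => (hd t ht).differentiableAt.differentiableWithinAt)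
      (fun t ht => (hd t ht).deriv) hw (Metric.mem_ball_self hε)
  refine Metric.eventually_nhds_iff_ball.2 ⟨ε, hε, ?_⟩
  rw [← ball_prod_same]
  rintro ⟨u, w⟩ ⟨hu, hw⟩
  refine ⟨hconst u hu w hw, ?_⟩
  have he : (fun t => B (t, c)) =ᶠ[𝓝 u] fun t => B (t, w) := by
    filter_upwards [Metric.isOpen_ball.mem_nhds hu] with t ht using (hconst t ht w hw).symm
  rw [he.deriv_eq]
  exact (hasDerivAt_mk_left (hB (u, w) ⟨hu, hw⟩).1).deriv

lemma eventually_eq_of_fderiv_fst_eq_zero {B : ℝ × ℝ → ℝ} {a c : ℝ}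
    (h : ∀ᶠ p in 𝓝 (a, c), DifferentiableAt ℝ B p ∧ fderiv ℝ B p (1, 0) = 0) :
    ∀ᶠ p in 𝓝 (a, c), B p = B (a, p.2) ∧
      deriv (fun w => B (a, w)) p.2 = fderiv ℝ B p (0, 1) := by
  have hsw (p : ℝ × ℝ) (hp : DifferentiableAt ℝ B p.swap) :
      HasFDerivAt (fun p : ℝ × ℝ => B p.swap)
        ((fderiv ℝ B p.swap).comp (ContinuousLinearEquiv.prodComm ℝ ℝ ℝ : ℝ × ℝ →L[ℝ] ℝ × ℝ)) p :=
    hp.hasFDerivAt.comp p (ContinuousLinearEquiv.prodComm ℝ ℝ ℝ).hasFDerivAt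
  have ht : Filter.Tendsto Prod.swap (𝓝 (c, a)) (𝓝 (a, c)) := continuous_swap.tendsto (c, a)
  have ht' : Filter.Tendsto Prod.swap (𝓝 (a, c)) (𝓝 (c, a)) := continuous_swap.tendsto (a, c)
  have h' : ∀ᶠ p in 𝓝 (c, a), DifferentiableAt ℝ (fun p : ℝ × ℝ => B p.swap) p ∧
      fderiv ℝ (fun p : ℝ × ℝ => B p.swap) p (0, 1) = 0 := by
    filter_upwards [ht.eventually h] with p hp
    refine ⟨(hsw p hp.1).differentiableAt, ?_⟩
    rw [(hsw p hp.1).fderiv]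
    exact hp.2
  filter_upwards [ht'.eventually (eventually_eq_of_fderiv_snd_eq_zero h'), h] with p hp hp'
  refine ⟨hp.1, hp.2.trans ?_⟩
  rw [(hsw p.swap hp'.1).fderiv]
  rfl

/-! ### Transversal planes and the obstruction to transversal surfaces. -/

lemma mem_transPlane_exWeb (z : M4) (ξ : V2) (v : M4) : v ∈ transPlane exWeb z ξ ↔
    ξ 1 * ((z.1 1 - z.2 1) * v.1 0 + (z.1 0 + z.2 0) * v.1 1)
        - ξ 0 * ((z.1 1 + z.2 1) * v.1 0 + (z.1 0 - z.2 0) * v.1 1) = 0 ∧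
      ξ 1 * ((z.1 1 - z.2 1) * v.2 0 - (z.1 0 + z.2 0) * v.2 1)
        - ξ 0 * (-(z.1 1 + z.2 1) * v.2 0 + (z.1 0 - z.2 0) * v.2 1) = 0 := by
  rw [← omega1_exWeb_zero, ← omega1_exWeb_one, ← omega2_exWeb_zero, ← omega2_exWeb_one]
  rfl

/-- The slopes of a basis of a transversal plane. -/
lemma slopes_of_mem_transPlane {z : M4} (hz : z ∈ dom) {η : V2} (hη : η ≠ 0) {v w : M4}
    (hv : v ∈ transPlane exWeb z η) (hw : w ∈ transPlane exWeb z η)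
    (v0 : v.1 0 = 1) (v1 : v.2 0 = 0) (w0 : w.1 0 = 0) (w1 : w.2 0 = 1) :
    v.2 1 = 0 ∧ w.1 1 = 0 ∧
      z.1 1 * (z.1 1 + z.1 0 * v.1 1) - z.2 1 * (z.2 1 + z.2 0 * w.2 1)
        - w.2 1 * (z.1 0 * (z.1 1 + z.1 0 * v.1 1))
        + v.1 1 * (z.2 0 * (z.2 1 + z.2 0 * w.2 1)) = 0 := by
  have hd : dlt z ≠ 0 := hz
  rw [mem_transPlane_exWeb, v0, v1] at hv
  rw [mem_transPlane_exWeb, w0, w1] at hw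
  obtain ⟨hv1, hv2⟩ := hv
  obtain ⟨hw1, hw2⟩ := hw
  have hη' : ¬ (η 0 = 0 ∧ η 1 = 0) := fun h =>
    hη (funext fun i => by fin_cases i <;> simp [h.1, h.2])
  have hdη : ¬ (dlt z * η 0 = 0 ∧ dlt z * η 1 = 0) := fun h =>
    hη' ⟨(mul_eq_zero.1 h.1).resolve_left hd, (mul_eq_zero.1 h.2).resolve_left hd⟩
  simp only [dlt] at hdη
  refine ⟨?_, ?_, ?_⟩
  -- A transversal plane is the sum of a line in the x-plane and a line in the y-plane. If `v.2 1` ≠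
  -- 0, the form cutting out the y-line vanishes identically, and δ ≠ 0 then gives η = 0.
  · by_contra hne
    have m1 : -η 1 * (z.1 0 + z.2 0) - η 0 * (z.1 0 - z.2 0) = 0 :=
      (mul_eq_zero.1 (by linear_combination hv2 : _ * v.2 1 = 0)).resolve_right hne
    have m0 : η 1 * (z.1 1 - z.2 1) + η 0 * (z.1 1 + z.2 1) = 0 := by
      linear_combination hw2 - w.2 1 * m1
    exact hdη ⟨by linear_combination (z.1 0 + z.2 0) / 2 * m0 + (z.1 1 - z.2 1) / 2 * m1,
      by linear_combination -(z.1 0 - z.2 0) / 2 * m0 - (z.1 1 + z.2 1) / 2 * m1⟩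
  · by_contra hne
    have l1 : η 1 * (z.1 0 + z.2 0) - η 0 * (z.1 0 - z.2 0) = 0 :=
      (mul_eq_zero.1 (by linear_combination hw1 : _ * w.1 1 = 0)).resolve_right hne
    have l0 : η 1 * (z.1 1 - z.2 1) - η 0 * (z.1 1 + z.2 1) = 0 := by
      linear_combination hv1 - v.1 1 * l1
    exact hdη ⟨by linear_combination -(z.1 0 + z.2 0) / 2 * l0 + (z.1 1 - z.2 1) / 2 * l1,
      by linear_combination -(z.1 0 - z.2 0) / 2 * l0 + (z.1 1 + z.2 1) / 2 * l1⟩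
  -- Up to a constant factor, the bracket is the determinant of the linear system `hv1`, `hw2` in η,
  -- which has a nonzero solution.
  · by_contra hne
    refine hη' ⟨mul_right_cancel₀ hne ?_, mul_right_cancel₀ hne ?_⟩
    · linear_combination
        (-(z.1 1 - z.2 1 - (z.1 0 + z.2 0) * w.2 1) / 2) * hv1
          + (z.1 1 - z.2 1 + (z.1 0 + z.2 0) * v.1 1) / 2 * hw2
    · linear_combination
        (-(-(z.1 1 + z.2 1) + (z.1 0 - z.2 0) * w.2 1) / 2) * hv1
          + (z.1 1 + z.2 1 + (z.1 0 - z.2 0) * v.1 1) / 2 * hw2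

/-- No surface with transversal tangent planes is tangent to the transversal plane which contains
the vector `∂/∂x¹`, at points where `ρ x² ((x²)² - (y²)²) ≠ 0`. -/
lemma not_exists_transversal_surface {U : Set M4} (hU : U ⊆ dom) {z : M4} (hz : z ∈ U)
    (hρ : rho z ≠ 0) (hb : z.1 1 ≠ 0) (hbd : z.1 1 ^ 2 - z.2 1 ^ 2 ≠ 0) :
    ¬ IsTransversallyGeodesicOn exWeb U := by
  intro hT
  have hd : dlt z ≠ 0 := hU hz
  obtain ⟨O, φ, h0, hφ0, hm, ⟨hO, hc, -⟩, ht0, ht⟩ := hT z hz ![z.1 1 - z.2 1, z.1 1 + z.2 1] (by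
    intro h
    have e0 := congrFun h 0
    have e1 := congrFun h 1
    simp at e0 e1
    exact hb (by linarith))
  obtain ⟨v, hv⟩ : ((![1, 0], 0) : M4) ∈ tangentPlane φ 0 := by
    rw [ht0, mem_transPlane_exWeb]
    constructor <;> simp; ring
  -- The slope solves the determinant equation with x-slope 0. As ρ ≠ 0 it is finite, so x¹, y¹ are
  -- local parameters on the surface.
  obtain ⟨w, hw⟩ : ((0, ![1, (z.1 1 ^ 2 - z.2 1 ^ 2) / rho z]) : M4) ∈ tangentPlane φ 0 := by
    rw [ht0, mem_transPlane_exWeb]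
    constructor
    · simp
    · simp
      field_simp
      simp only [rho]
      ring
  rw [ContinuousLinearMap.coe_coe] at hv hw
  have hc2 (s : ℝ × ℝ) (hs : s ∈ O) : ContDiffAt ℝ 2 φ s :=
    contDiffAt_infty.1 (hc.contDiffAt (hO.mem_nhds hs)) 2
  have hD (s : ℝ × ℝ) (hs : s ∈ O) : HasFDerivAt φ (fderiv ℝ φ s) s :=
    ((hc2 s hs).differentiableAt two_ne_zero).hasFDerivAt
  have hΦ : ContDiffAt ℝ 2 (fun s => ((φ s).1 0, (φ s).2 0)) 0 :=
    ((dX 0).contDiff.contDiffAt.comp 0 (hc2 0 h0)).prodMk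
      ((dY 0).contDiff.contDiffAt.comp 0 (hc2 0 h0))
  have hΦD : HasFDerivAt (fun s => ((φ s).1 0, (φ s).2 0))
      (((dX 0).comp (fderiv ℝ φ 0)).prod ((dY 0).comp (fderiv ℝ φ 0))) 0 :=
    ((dX 0).hasFDerivAt.comp 0 (hD 0 h0)).prodMk ((dY 0).hasFDerivAt.comp 0 (hD 0 h0))
  obtain ⟨g, hg, hg0, hgr⟩ := exists_contDiffAt_rightInverse hΦ (fun q =>
    ⟨q.1 • v + q.2 • w, by rw [hΦD.fderiv]; ext <;> simp [hv, hw]⟩)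
  simp only [hφ0] at hg hg0 hgr
  set a := z.1 0 with ha
  set c := z.2 0 with hcc
  have hψ2 : ContDiffAt ℝ 2 (fun p => φ (g p)) (a, c) :=
    ContDiffAt.comp (a, c) (by rw [hg0]; exact hc2 0 h0) hg
  have hgO : ∀ᶠ p in 𝓝 (a, c), g p ∈ O :=
    hg.continuousAt.eventually (by rw [hg0]; exact hO.mem_nhds h0)
  have hgd : ∀ᶠ p in 𝓝 (a, c), DifferentiableAt ℝ g p :=
    (hg.eventually (by simp)).mono fun p hp => hp.differentiableAt two_ne_zero
  -- the partial derivatives of the surface in the coordinates `x¹`, `y¹`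
  have htan : ∀ᶠ p in 𝓝 (a, c), DifferentiableAt ℝ (fun p => φ (g p)) p ∧
      (∀ v, fderiv ℝ (fun p => φ (g p)) p v ∈ tangentPlane φ (g p)) ∧
      (∀ v, (fderiv ℝ (fun p => φ (g p)) p v).1 0 = v.1) ∧
      ∀ v, (fderiv ℝ (fun p => φ (g p)) p v).2 0 = v.2 := by
    filter_upwards [hgO, hgd, hgr.eventually_nhds] with p hp hp' hr
    have hψ := (hD (g p) hp).comp p hp'.hasFDerivAt
    have hψ' : DifferentiableAt ℝ (fun p => φ (g p)) p := hψ.differentiableAt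
    refine ⟨hψ', fun v => ⟨fderiv ℝ g p v, ?_⟩, fun v => ?_, fun v => ?_⟩
    · exact congrArg (fun L => L v) hψ.fderiv.symm
    · have h1 : HasFDerivAt (fun p => (φ (g p)).1 0) _ p := (dX 0).hasFDerivAt.comp p hψ'.hasFDerivAt
      have h2 := h1.congr_of_eventuallyEq (f₁ := Prod.fst)
        (hr.mono fun q hq => (congrArg Prod.fst hq).symm)
      exact congrArg (fun L => L v) (h2.unique hasFDerivAt_fst)
    · have h1 : HasFDerivAt (fun p => (φ (g p)).2 0) _ p := (dY 0).hasFDerivAt.comp p hψ'.hasFDerivAt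
      have h2 := h1.congr_of_eventuallyEq (f₁ := Prod.snd)
        (hr.mono fun q hq => (congrArg Prod.snd hq).symm)
      exact congrArg (fun L => L v) (h2.unique hasFDerivAt_snd)
  have hB (p : ℝ × ℝ) (hp : DifferentiableAt ℝ (fun p => φ (g p)) p) :
      HasFDerivAt (fun p => (φ (g p)).1 1) ((dX 1).comp (fderiv ℝ (fun p => φ (g p)) p)) p :=
    (dX 1).hasFDerivAt.comp p hp.hasFDerivAt
  have hC (p : ℝ × ℝ) (hp : DifferentiableAt ℝ (fun p => φ (g p)) p) :
      HasFDerivAt (fun p => (φ (g p)).2 1) ((dY 1).comp (fderiv ℝ (fun p => φ (g p)) p)) p :=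
    (dY 1).hasFDerivAt.comp p hp.hasFDerivAt
  have hslopes : ∀ᶠ p in 𝓝 (a, c),
      (fderiv ℝ (fun p => φ (g p)) p (1, 0)).2 1 = 0 ∧
      (fderiv ℝ (fun p => φ (g p)) p (0, 1)).1 1 = 0 ∧
      (φ (g p)).1 1 * ((φ (g p)).1 1 +
          (φ (g p)).1 0 * (fderiv ℝ (fun p => φ (g p)) p (1, 0)).1 1)
        - (φ (g p)).2 1 * ((φ (g p)).2 1 +
          (φ (g p)).2 0 * (fderiv ℝ (fun p => φ (g p)) p (0, 1)).2 1)
        - (fderiv ℝ (fun p => φ (g p)) p (0, 1)).2 1 * ((φ (g p)).1 0 * ((φ (g p)).1 1 +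
          (φ (g p)).1 0 * (fderiv ℝ (fun p => φ (g p)) p (1, 0)).1 1))
        + (fderiv ℝ (fun p => φ (g p)) p (1, 0)).1 1 * ((φ (g p)).2 0 * ((φ (g p)).2 1 +
          (φ (g p)).2 0 * (fderiv ℝ (fun p => φ (g p)) p (0, 1)).2 1)) = 0 := by
    filter_upwards [hgO, htan] with p hp ⟨_, h1, h2, h3⟩
    obtain ⟨η, hη, hT⟩ := ht (g p) hp
    rw [hT] at h1
    exact slopes_of_mem_transPlane (hU (hm hp)) hη (h1 (1, 0)) (h1 (0, 1)) (h2 _) (h3 _) (h2 _)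
      (h3 _)
  have hβ := eventually_eq_of_fderiv_snd_eq_zero (B := fun p => (φ (g p)).1 1) (a := a) (c := c) (by
    filter_upwards [htan, hslopes] with p hp hs
    refine ⟨(hB p hp.1).differentiableAt, ?_⟩
    rw [(hB p hp.1).fderiv]
    exact hs.2.1)
  have hγ := eventually_eq_of_fderiv_fst_eq_zero (B := fun p => (φ (g p)).2 1) (a := a) (c := c) (by
    filter_upwards [htan, hslopes] with p hp hs
    refine ⟨(hC p hp.1).differentiableAt, ?_⟩
    rw [(hC p hp.1).fderiv]
    exact hs.1)
  -- The x-line of the chosen plane is spanned by ∂/∂x¹.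
  have hp0 : deriv (fun u => (φ (g (u, c))).1 1) a = 0 := by
    have h1 := htan.self_of_nhds
    have h2 := h1.2.1 (1, 0)
    rw [hβ.self_of_nhds.2, (hB _ h1.1).fderiv]
    rw [hg0, ht0, mem_transPlane_exWeb, h1.2.2.1] at h2
    have h3 := h2.1
    simp at h3 ⊢
    apply (mul_eq_zero.1 (?_ : dlt z * _ = 0)).resolve_left hd
    simp only [dlt]
    linear_combination h3 / 2
  have hβ2 : ContDiffAt ℝ 2 (fun u => φ (g (u, c))) a :=
    ContDiffAt.comp (g := fun p => φ (g p)) (f := fun u => (u, c)) a hψ2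
      (contDiff_id.prodMk contDiff_const).contDiffAt
  have hγ2 : ContDiffAt ℝ 2 (fun w => φ (g (a, w))) c :=
    ContDiffAt.comp (g := fun p => φ (g p)) (f := fun w => (a, w)) c hψ2
      (contDiff_const.prodMk contDiff_id).contDiffAt
  have key := mul_dlt_eq_zero_of_graph (a := a) (c := c) (β := fun u => (φ (g (u, c))).1 1)
    (γ := fun w => (φ (g (a, w))).2 1)
    ((dX 1).contDiff.contDiffAt.comp a hβ2)
    ((dY 1).contDiff.contDiffAt.comp c hγ2)
    (by
      filter_upwards [hβ, hγ, hslopes, htan, hgr] with p hβ hγ hs hp hr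
      have hr1 := congrArg Prod.fst hr
      have hr2 := congrArg Prod.snd hr
      have := hs.2.2
      rw [← hβ.1, ← hγ.1, hβ.2, hγ.2, (hB p hp.1).fderiv, (hC p hp.1).fderiv]
      simp only at hr1 hr2
      rw [hr1, hr2] at this
      exact this) hp0
  simp only [hg0, hφ0, mul_eq_zero] at key
  rcases key with (h | h) | h
  · exact hb (by simpa using h)
  · exact hbd h
  · exact hd h

lemma exists_generic_mem {U : Set M4} (hU : IsOpen U) (hne : U.Nonempty) :
    ∃ z ∈ U, rho z ≠ 0 ∧ z.1 1 ≠ 0 ∧ z.1 1 ^ 2 - z.2 1 ^ 2 ≠ 0 := by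
  obtain ⟨z, hz⟩ := hne
  have hquad (p q : ℝ) : {t : ℝ | t ^ 2 + p * t + q = 0}.Finite := by
    have hP : (Polynomial.X ^ 2 + Polynomial.C p * Polynomial.X + Polynomial.C q :
        Polynomial ℝ) ≠ 0 := by
      intro h
      have := congrArg (fun P => Polynomial.coeff P 2) h
      simp at this
    exact (Polynomial.finite_setOfPred_isRoot hP).subset fun t ht => by simpa using ht
  -- Moving x¹ and x² together makes ρ, x² and (x²)² - (y²)² monic polynomials in t, each with
  -- finitely many zeros.
  let γ : ℝ → M4 := fun t => z + t • ((fun _ => 1, 0) : M4)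
  have hγ : Continuous γ := by fun_prop
  have hnhds : γ ⁻¹' U ∈ 𝓝 (0 : ℝ) := (hU.preimage hγ).mem_nhds (by
    change z + (0 : ℝ) • _ ∈ U
    rwa [zero_smul, add_zero])
  have hfin := ((hquad (z.1 0 + z.1 1) (rho z)).union (Set.finite_singleton (-z.1 1))).union
    (hquad (2 * z.1 1) (z.1 1 ^ 2 - z.2 1 ^ 2))
  obtain ⟨t, htU, ht⟩ := (infinite_of_mem_nhds 0 hnhds).exists_notMem_finite hfin
  simp only [Set.mem_union, Set.mem_ofPred_eq, Set.mem_singleton_iff, not_or] at ht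
  obtain ⟨⟨h1, h2⟩, h3⟩ := ht
  refine ⟨γ t, htU, fun h => h1 ?_, fun h => h2 ?_, fun h => h3 ?_⟩
  · simp [γ, rho] at h ⊢; linarith
  · simp [γ] at h; linarith
  · simp [γ] at h; linarith

end ThreeWeb

theorem mainTheorem7 :
    -- the equations define a web on the domain
    IsWebOn exWeb dom ∧
    -- the covector `a`, and the invariants `p`, `q`
    (∀ z ∈ dom, covec exWeb 0 z = covec exWeb 1 z ∧ covec exWeb 0 z = -rho z / dlt z ^ 2) ∧
    (∀ z ∈ dom, pInv exWeb z = qInv exWeb z ∧ pInv exWeb z = rho z * sigm z / dlt z ^ 4) ∧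
    (∀ z ∈ domN, pInv exWeb z = qInv exWeb z ∧ pInv exWeb z ≠ 0) ∧
    -- the tensor conditions
    (∀ z ∈ dom, EqualCovecCond exWeb z ∧ ParallelCond exWeb z ∧ IntegrabilityCond exWeb z ∧
      HexagonalCond exWeb z) ∧
    -- the transversal distribution is `ω¹ + ω² = 0`, and it is integrable
    (∀ z ∈ domA, ∀ v : M4, v ∈ aDist exWeb z ↔
      omega1 exWeb 0 z v + omega1 exWeb 1 z v = 0 ∧
      omega2 exWeb 0 z v + omega2 exWeb 1 z v = 0) ∧
    IsIntegrableOn (aDist exWeb) domA ∧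
    -- its integral surfaces are geodesically parallel in all connections of the bundle
    (∀ P Q : M4 → ℝ, IsGeodesicallyParallelOn exWeb P Q (aDist exWeb) domA) ∧
    -- its integral surfaces carry hexagonal two-dimensional webs
    (∀ (O : Set (ℝ × ℝ)) (φ : ℝ × ℝ → M4), Set.MapsTo φ O domA →
      IsIntegralSurface (aDist exWeb) O φ → CutsHexagonalWeb exWeb O φ) ∧
    -- the web is not transversally geodesic
    (∀ z ∈ domN, ¬ CurvSymIsTrace exWeb z) ∧
    (∀ U : Set M4, IsOpen U → U.Nonempty → U ⊆ dom → ¬ IsTransversallyGeodesicOn exWeb U) := by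
  refine ⟨isWebOn_exWeb, fun z hz => ⟨by rw [covec_exWeb hz, covec_exWeb hz], covec_exWeb hz 0⟩,
    fun z hz => ⟨by rw [pInv_exWeb hz, qInv_exWeb hz], pInv_exWeb hz⟩, fun z hz => ?_,
    fun z hz => ⟨equalCovecCond_exWeb hz, parallelCond_exWeb hz, integrabilityCond_exWeb hz,
      hexagonalCond_exWeb hz⟩,
    fun z hz v => mem_aDist_exWeb hz v, isIntegrableOn_aDist_exWeb, isGeodesicallyParallelOn_exWeb,
    fun O φ hm hφ => cutsHexagonalWeb_of_isIntegralSurface hm hφ,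
    fun z hz => not_curvSymIsTrace_exWeb hz, fun U hU hne hUd => ?_⟩
  · have hzd : z ∈ dom := hz.1
    rw [pInv_exWeb hzd, qInv_exWeb hzd]
    exact ⟨rfl, div_ne_zero (mul_ne_zero hz.2.1 hz.2.2) (pow_ne_zero 4 hz.1)⟩
  · obtain ⟨z, hz, h1, h2, h3⟩ := exists_generic_mem hU hne
    exact not_exists_transversal_surface hUd hz h1 h2 h3
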